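/- Let $K$ be a field with a real valuation $|\cdot|:K\to\mathbb R_{\ge 0}$, that is, $|a|=0\iff a=0$, $|ab|=|a||b|$ and $|a+b|\le|a|+|b|$ (the trivial valuation is allowed, and $K$ need not be complete). For $n\ge 0$ let $K\{x_1,\dots,x_n\}$ be the ring of convergent power series over $K$, i.e. of those formal power series $\sum_\alpha c_\alpha x^\alpha$ with $\sum_\alpha |c_\alpha|\varepsilon^\alpha<\infty$ for some $\varepsilon\in(\mathbb R_{>0})^n$. Two elements $f,g$ of such a ring are called right equivalent in it if $f=\varphi(g)$ for some $K$-algebra automorphism $\varphi$ of the ring. **Proposition 2.7** (uniqueness of the residual part in the splitting lemma). Let $0\le k\le n$ and let $$f_0=q(x_1,\dots,x_k)+g_0(x_{k+1},\dots,x_n),\qquad f_1=q(x_1,\dots,x_k)+g_1(x_{k+1},\dots,x_n)$$ with $g_0,g_1\in K\{x_{k+1},\dots,x_n\}$, where 1. if $\operatorname{char}K\ne 2$: $q=a_1x_1^2+\dots+a_kx_k^2$ with $a_i\in K$, $a_i\ne 0$, and $g_0,g_1\in\langle x_{k+1},\dots,x_n\rangle^3$; 2. if $\operatorname{char}K=2$: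 $k=2l$ is even, $q=\sum_{i\text{ odd},\,1\le i\le k-1}(a_ix_i^2+x_ix_{i+1}+a_{i+1}x_{i+1}^2)$ with $a_i\in K$, and $g_j=\sum_{i=k+1}^n d_ix_i^2+h_j$ for $j=0,1$, with $d_i\in K$, $d_i\neq 0$ (the same $d_i$ for $j=0$ and $j=1$) and $h_0,h_1\in\langle x_{k+1},\dots,x_n\rangle^3$. If $f_0$ and $f_1$ are right equivalent in $K\{x_1,\dots,x_n\}$, then $g_0$ and $g_1$ are right equivalent in $K\{x_{k+1},\dots,x_n\}$. -/

import Mathlib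

open scoped NNReal ENNReal

noncomputable section

namespace SplittingLemma

variable {σ τ : Type*} [Fintype σ] [Fintype τ] {K : Type*} [NormedField K]

/-- The weighted norm `∑_α |c_α| ε^α ∈ [0, ∞]` of a formal power series `f = ∑_α c_α x^α` over a
normed field (a field with a real valuation, possibly trivial, possibly not complete). -/
def weightedNorm (ε : σ → ℝ≥0) (f : MvPowerSeries σ K) : ℝ≥0∞ :=
  ∑' α : σ →₀ ℕ, ‖MvPowerSeries.coeff α f‖ₑ * ∏ i, (ε i : ℝ≥0∞) ^ α i

/-- A formal power series is convergent if its weighted norm is finite for some vector `ε` of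
positive real numbers. -/
def IsConvergent (f : MvPowerSeries σ K) : Prop :=
  ∃ ε : σ → ℝ≥0, (∀ i, 0 < ε i) ∧ weightedNorm ε f < ∞

theorem weightedNorm_mono {ρ ε : σ → ℝ≥0} (h : ρ ≤ ε) (f : MvPowerSeries σ K) :
    weightedNorm ρ f ≤ weightedNorm ε f := by
  refine ENNReal.tsum_le_tsum fun α => ?_
  gcongr with i
  exact h i

theorem weightedNorm_add_le (ε : σ → ℝ≥0) (f g : MvPowerSeries σ K) :
    weightedNorm ε (f + g) ≤ weightedNorm ε f + weightedNorm ε g := by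
  unfold weightedNorm
  rw [← ENNReal.tsum_add]
  refine ENNReal.tsum_le_tsum fun α => ?_
  rw [map_add, ← add_mul]
  gcongr
  exact enorm_add_le _ _

theorem weightedNorm_mul_le (ε : σ → ℝ≥0) (f g : MvPowerSeries σ K) :
    weightedNorm ε (f * g) ≤ weightedNorm ε f * weightedNorm ε g := by
  classical
  have key : weightedNorm ε f * weightedNorm ε g
      = ∑' p : Σ n : σ →₀ ℕ, Finset.HasAntidiagonal.antidiagonal n,
        (‖MvPowerSeries.coeff p.2.1.1 f‖ₑ * ∏ i, (ε i : ℝ≥0∞) ^ p.2.1.1 i) *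
        (‖MvPowerSeries.coeff p.2.1.2 g‖ₑ * ∏ i, (ε i : ℝ≥0∞) ^ p.2.1.2 i) := by
    unfold weightedNorm
    rw [← ENNReal.tsum_mul_right]
    simp_rw [← ENNReal.tsum_mul_left]
    rw [← ENNReal.tsum_prod,
      ← (Finset.HasAntidiagonal.sigmaAntidiagonalEquivProd (A := σ →₀ ℕ)).tsum_eq]
    rfl
  rw [key, ENNReal.tsum_sigma', weightedNorm]
  refine ENNReal.tsum_le_tsum fun n => ?_
  rw [MvPowerSeries.coeff_mul, tsum_fintype, ← Finset.sum_coe_sort]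
  refine (mul_le_mul_left (enorm_sum_le _ _) _).trans ?_
  rw [Finset.sum_mul]
  refine Finset.sum_le_sum fun p _ => le_of_eq ?_
  have hp (i : σ) : n i = p.1.1 i + p.1.2 i :=
    (DFunLike.congr_fun (Finset.HasAntidiagonal.mem_antidiagonal.mp p.2) i).symm
  simp only [enorm_mul, hp, pow_add, Finset.prod_mul_distrib]
  ring

theorem weightedNorm_monomial (ε : σ → ℝ≥0) (β : σ →₀ ℕ) (c : K) :
    weightedNorm ε (MvPowerSeries.monomial β c) = ‖c‖ₑ * ∏ i, (ε i : ℝ≥0∞) ^ β i := by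
  classical
  unfold weightedNorm
  rw [tsum_eq_single β]
  · simp
  · intro α hα
    simp [MvPowerSeries.coeff_monomial, hα]

theorem isConvergent_monomial (β : σ →₀ ℕ) (c : K) :
    IsConvergent (MvPowerSeries.monomial β c) := by
  refine ⟨fun _ => 1, fun _ => one_pos, ?_⟩
  rw [weightedNorm_monomial]
  simp

theorem IsConvergent.common {f g : MvPowerSeries σ K} (hf : IsConvergent f)
    (hg : IsConvergent g) :
    ∃ ε : σ → ℝ≥0, (∀ i, 0 < ε i) ∧ weightedNorm ε f < ∞ ∧ weightedNorm ε g < ∞ := by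
  obtain ⟨ε, hε, h⟩ := hf
  obtain ⟨ρ, hρ, h'⟩ := hg
  exact ⟨ε ⊓ ρ, fun i => lt_min (hε i) (hρ i), (weightedNorm_mono inf_le_left f).trans_lt h,
    (weightedNorm_mono inf_le_right g).trans_lt h'⟩

variable (σ K) in
/-- The ring `K{x}` of convergent power series in the variables `x_i`, `i ∈ σ`, as a subalgebra of
the ring of formal power series. -/
def ConvSeries : Subalgebra K (MvPowerSeries σ K) where
  carrier := {f | IsConvergent f}
  mul_mem' {f g} hf hg := by
    obtain ⟨ε, hε, h, h'⟩ := IsConvergent.common hf hg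
    exact ⟨ε, hε, (weightedNorm_mul_le ε f g).trans_lt (ENNReal.mul_lt_top h h')⟩
  add_mem' {f g} hf hg := by
    obtain ⟨ε, hε, h, h'⟩ := IsConvergent.common hf hg
    exact ⟨ε, hε, (weightedNorm_add_le ε f g).trans_lt (ENNReal.add_lt_top.mpr ⟨h, h'⟩)⟩
  algebraMap_mem' r := isConvergent_monomial 0 r

namespace ConvSeries

variable (K) in
/-- The variable `x_i` as an element of `K{x}`. -/
def X (i : σ) : ConvSeries σ K :=
  ⟨MvPowerSeries.X i, isConvergent_monomial (Finsupp.single i 1) 1⟩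

variable (σ K) in
/-- The ideal `𝔪 = ⟨x_i : i ∈ σ⟩` of `K{x}`. -/
def maxIdeal : Ideal (ConvSeries σ K) := Ideal.span (Set.range (X K))

theorem weightedNorm_rename (e : σ ↪ τ) (ε : τ → ℝ≥0) (f : MvPowerSeries σ K) :
    weightedNorm ε (MvPowerSeries.rename e f) = weightedNorm (ε ∘ e) f := by
  unfold weightedNorm
  rw [← (Finsupp.embDomain_injective e).tsum_eq]
  · refine tsum_congr fun α => ?_
    rw [MvPowerSeries.coeff_embDomain_rename]
    congr 1
    rw [← Finset.prod_subset (Finset.subset_univ (Finset.univ.map e))]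
    · simp
    · intro j _ hj
      rw [Finsupp.embDomain_of_notMem_range, pow_zero]
      simpa using hj
  · intro β hβ
    by_contra h
    apply hβ
    simp only
    rw [MvPowerSeries.coeff_rename_eq_zero, enorm_zero, zero_mul]
    rintro ⟨α, rfl⟩
    exact h ⟨α, Finsupp.embDomain_eq_mapDomain e α⟩

/-- Viewing a convergent power series in the variables `x_i`, `i ∈ σ`, as a convergent power
series in more variables, along an embedding of the index sets. -/
def incl (e : σ ↪ τ) : ConvSeries σ K →ₐ[K] ConvSeries τ K :=
  ((MvPowerSeries.rename (R := K) e).comp (ConvSeries σ K).val).codRestrict (ConvSeries τ K) (by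
    rintro ⟨f, ε, hε, h⟩
    classical
    refine ⟨Function.extend e ε 1, fun j => ?_, ?_⟩
    · by_cases hj : ∃ i, e i = j
      · obtain ⟨i, rfl⟩ := hj
        rw [e.injective.extend_apply]
        exact hε i
      · rw [Function.extend_apply' _ _ _ hj]
        exact one_pos
    · change weightedNorm _ (MvPowerSeries.rename e f) < ∞
      have he : Function.extend e ε 1 ∘ e = ε := funext fun i => e.injective.extend_apply _ _ i
      rwa [weightedNorm_rename, he])

/-- Right equivalence: `f = φ(g)` for some automorphism `φ` of the `K`-algebra `K{x}`. -/
def RightEquiv (f g : ConvSeries σ K) : Prop :=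
  ∃ φ : ConvSeries σ K ≃ₐ[K] ConvSeries σ K, f = φ g

/-- The diagonal quadratic form `a₁ x₁² + ⋯ + a_k x_k²` in `K{x₁, …, x_{k+m}}`. -/
def diagForm {k : ℕ} (m : ℕ) (a : Fin k → K) : ConvSeries (Fin (k + m)) K :=
  ∑ i : Fin k, a i • X K (Fin.castAdd m i) ^ 2

/-- The quadratic form `∑_{i odd, 1 ≤ i ≤ 2l - 1} (a_i x_i² + x_i x_{i+1} + a_{i+1} x_{i+1}²)` in
`K{x₁, …, x_{2l+m}}`; with indices counted from zero the `j`-th block has the variables of index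
`2j` and `2j + 1`. -/
def blockForm {l : ℕ} (m : ℕ) (a : Fin (2 * l) → K) : ConvSeries (Fin (2 * l + m)) K :=
  ∑ j : Fin l,
    (a ⟨2 * j, by omega⟩ • X K ⟨2 * j, by omega⟩ ^ 2
      + X K ⟨2 * j, by omega⟩ * X K ⟨2 * j + 1, by omega⟩
      + a ⟨2 * j + 1, by omega⟩ • X K ⟨2 * j + 1, by omega⟩ ^ 2)

/-- A power series in the last `m` variables `x_{k+1}, …, x_{k+m}`, viewed in
`K{x₁, …, x_{k+m}}`. The source ring has its variables indexed by `Fin m`, the `i`-th of them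
being `x_{k+i}`. -/
def inLast (k : ℕ) {m : ℕ} : ConvSeries (Fin m) K →ₐ[K] ConvSeries (Fin (k + m)) K :=
  incl (Fin.natAddEmb k)

end ConvSeries

end SplittingLemma

end

noncomputable section

open Filter Topology

set_option linter.unusedSectionVars false

namespace SplittingLemma

variable {σ τ : Type*} [Fintype σ] [Fintype τ] {K : Type*} [NormedField K]

/-! ### Weighted norms -/

/-! Write `y` for the variables of `q`, `x` for the others, and let `φ` be the automorphism, so that
`q(y) + g₀(x) = q(φ(y)) + g₁(φ(x))`. If `y = ψ(x)` can be chosen so that `q(φ(y)) = q(y)` after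
substitution, then `g₀(x) = g₁(θ(x))`, where `θ(x)` is `φ(x)` at `y = ψ(x)`; it remains to see that
`θ` is invertible.

For `ψ`, impose linear equations `P φ(y) + R y = 0` that force `q(φ(y)) = q(y)`. With `A = ∂φ(y)/∂y`
at the origin, the implicit function theorem `exists_algHom_of_isUnit_jacobian` solves them once `P
A + R` is invertible, that is, once `{P u + R v = 0}` is a complement of the graph `{(A v, v)}`.
Such a complement, isotropic for `q(u) - q(v)`, is built block by block in
`exists_isUnit_blockDiagonal_mul_add`: blocks of one variable if `2 ≠ 0`, and of two variables if `2
= 0` (`exists_isUnit_mul_add_of_two_eq_zero`).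

For `θ`, compare Hessians at the origin. That of `q` is invertible and those of `g₀`, `g₁` vanish,
in characteristic two also in the presence of squares. This forces `∂φ(y)/∂x = 0`
(`toBlocks₁₂_jacobian_eq_zero`). Hence `ψ` has no linear terms, the Jacobian of `θ` is the
invertible block `∂φ(x)/∂x`, and the inverse function theorem `bijective_of_isUnit_jacobian`
applies.

Convergence in the implicit function theorem comes from uniform bounds on the iterates of a fixed
point equation (`isConvergent_fixedPoint`), so `K` need not be complete. An abstract algebra
homomorphism is handled through `constCoeff_algHom` and `algHom_ext`. -/

theorem prod_pow_pow_eq_pow_weight (w : σ → ℕ) (t : ℝ≥0∞) (α : σ →₀ ℕ) :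
    ∏ i, (t ^ w i) ^ α i = t ^ Finsupp.weight w α := by
  simp_rw [Finsupp.weight_eq_sum, ← pow_mul, Finset.prod_pow_eq_pow_sum, smul_eq_mul, mul_comm]

theorem weightedNorm_C (ε : σ → ℝ≥0) (c : K) :
    weightedNorm ε (MvPowerSeries.C c) = ‖c‖ₑ := by
  have := weightedNorm_monomial ε 0 c
  simpa using this

theorem weightedNorm_X (ε : σ → ℝ≥0) (i : σ) :
    weightedNorm ε (MvPowerSeries.X i : MvPowerSeries σ K) = ε i := by
  classical
  rw [MvPowerSeries.X, weightedNorm_monomial]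
  rw [Finset.prod_eq_single i]
  · simp
  · intro j _ hj
    simp [hj.symm]
  · simp

theorem weightedNorm_pow_le (ε : σ → ℝ≥0) (f : MvPowerSeries σ K) (n : ℕ) :
    weightedNorm ε (f ^ n) ≤ weightedNorm ε f ^ n := by
  induction n with
  | zero =>
    rw [pow_zero, pow_zero, ← map_one MvPowerSeries.C, weightedNorm_C]
    simp
  | succ n ih =>
    rw [pow_succ, pow_succ]
    exact (weightedNorm_mul_le ε _ _).trans (by gcongr)

theorem weightedNorm_prod_le (ε : τ → ℝ≥0) (a : σ → MvPowerSeries τ K) (s : Finset σ) :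
    weightedNorm ε (∏ i ∈ s, a i) ≤ ∏ i ∈ s, weightedNorm ε (a i) := by
  classical
  induction s using Finset.induction_on with
  | empty =>
    rw [Finset.prod_empty, Finset.prod_empty, ← map_one MvPowerSeries.C, weightedNorm_C]
    simp
  | insert i s hi ih =>
    rw [Finset.prod_insert hi, Finset.prod_insert hi]
    exact (weightedNorm_mul_le ε _ _).trans (by gcongr)

/-- A convergent power series without terms of weight less than `N` is `O(t ^ N)` on the polydisc
of radii `t ^ w i`. -/
theorem IsConvergent.exists_weightedNorm_le {f : MvPowerSeries σ K} (hf : IsConvergent f)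
    {w : σ → ℕ} (hw : ∀ i, 1 ≤ w i) {N : ℕ}
    (hN : ∀ α, Finsupp.weight w α < N → MvPowerSeries.coeff α f = 0) :
    ∃ C : ℝ≥0∞, C ≠ ∞ ∧ ∀ᶠ t : ℝ≥0 in 𝓝[>] 0,
      weightedNorm (fun i => t ^ w i) f ≤ C * (t : ℝ≥0∞) ^ N := by
  obtain ⟨ε, hε, h⟩ := hf
  obtain ⟨r, hr0, hr1, hrε⟩ : ∃ r : ℝ≥0, 0 < r ∧ r ≤ 1 ∧ ∀ i, r ≤ ε i := by
    have : ∀ᶠ r : ℝ≥0 in 𝓝[>] 0, 0 < r ∧ r ≤ 1 ∧ ∀ i, r ≤ ε i := by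
      refine eventually_mem_nhdsWithin.and ?_
      refine Filter.Eventually.filter_mono nhdsWithin_le_nhds ?_
      exact (eventually_le_nhds one_pos).and (eventually_all.2 fun i => eventually_le_nhds (hε i))
    exact this.exists
  have hrt : (r : ℝ≥0∞) ^ N ≠ 0 := pow_ne_zero _ (by simpa using hr0.ne')
  have hrt' : (r : ℝ≥0∞) ^ N ≠ ∞ := ENNReal.pow_ne_top ENNReal.coe_ne_top
  -- Passing from radii `r ^ w i` to `t ^ w i` with `t ≤ r` multiplies a term of weight `M ≥ N` by
  -- `(t / r) ^ M ≤ (t / r) ^ N`.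
  refine ⟨weightedNorm (fun i => r ^ w i) f / r ^ N, ?_, ?_⟩
  · refine ENNReal.div_ne_top (ne_top_of_le_ne_top h.ne (weightedNorm_mono (fun i => ?_) f)) hrt
    exact (pow_le_of_le_one zero_le hr1 (by have := hw i; omega)).trans (hrε i)
  · filter_upwards [Filter.Eventually.filter_mono nhdsWithin_le_nhds (eventually_le_nhds hr0)]
      with t ht
    rw [← ENNReal.mul_div_right_comm, ENNReal.le_div_iff_mul_le (Or.inl hrt) (Or.inl hrt'),
      mul_comm, mul_comm _ ((t : ℝ≥0∞) ^ N)]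
    unfold weightedNorm
    rw [← ENNReal.tsum_mul_left, ← ENNReal.tsum_mul_left]
    refine ENNReal.tsum_le_tsum fun α => ?_
    push_cast
    rw [prod_pow_pow_eq_pow_weight, prod_pow_pow_eq_pow_weight]
    by_cases hα : Finsupp.weight w α < N
    · simp [hN α hα]
    · obtain ⟨M, hM⟩ := Nat.exists_eq_add_of_le (not_lt.1 hα)
      rw [hM, pow_add, pow_add]
      calc (r : ℝ≥0∞) ^ N * (‖MvPowerSeries.coeff α f‖ₑ * (t ^ N * t ^ M))
          = (r : ℝ≥0∞) ^ N * t ^ N * ‖MvPowerSeries.coeff α f‖ₑ * t ^ M := by ring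
        _ ≤ (r : ℝ≥0∞) ^ N * t ^ N * ‖MvPowerSeries.coeff α f‖ₑ * r ^ M := by gcongr
        _ = _ := by ring

theorem eventually_mul_coe_le {C : ℝ≥0∞} (hC : C ≠ ∞) {δ : ℝ≥0∞} (hδ : 0 < δ) :
    ∀ᶠ t : ℝ≥0 in 𝓝[>] 0, C * (t : ℝ≥0∞) ≤ δ := by
  refine Filter.Eventually.filter_mono nhdsWithin_le_nhds ?_
  have h : Tendsto (fun t : ℝ≥0 => C * (t : ℝ≥0∞)) (𝓝 0) (𝓝 (C * ((0 : ℝ≥0) : ℝ≥0∞))) :=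
    ENNReal.Tendsto.const_mul (ENNReal.continuous_coe.tendsto 0) (Or.inr hC)
  rw [ENNReal.coe_zero, mul_zero] at h
  exact h.eventually_le_const hδ

/-- A convergent power series without constant term is small on small polydiscs. -/
theorem IsConvergent.eventually_weightedNorm_le {f : MvPowerSeries σ K} (hf : IsConvergent f)
    (h0 : MvPowerSeries.constantCoeff f = 0) {δ : ℝ≥0∞} (hδ : 0 < δ) :
    ∀ᶠ t : ℝ≥0 in 𝓝[>] 0, weightedNorm (fun _ => t) f ≤ δ := by
  obtain ⟨C, hC, h⟩ := hf.exists_weightedNorm_le (w := fun _ => 1) (fun _ => le_rfl) (N := 1)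
    (by
      intro α hα
      have : α = 0 := by
        rw [Nat.lt_one_iff] at hα
        rwa [← Finsupp.degree_eq_zero_iff, Finsupp.degree_eq_weight_one]
      subst this
      simpa using h0)
  filter_upwards [h, eventually_mul_coe_le hC hδ] with t h1 h2
  simp only [pow_one] at h1
  exact h1.trans h2

/-- The weighted norm of the result of a substitution. -/
theorem weightedNorm_subst_le {a : σ → MvPowerSeries τ K} (ha : MvPowerSeries.HasSubst a)
    {ε : τ → ℝ≥0} {δ : σ → ℝ≥0} (h : ∀ i, weightedNorm ε (a i) ≤ δ i) (f : MvPowerSeries σ K) :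
    weightedNorm ε (MvPowerSeries.subst a f) ≤ weightedNorm δ f := by
  have key (e : τ →₀ ℕ) : ‖MvPowerSeries.coeff e (MvPowerSeries.subst a f)‖ₑ ≤
      ∑' d : σ →₀ ℕ, ‖MvPowerSeries.coeff d f‖ₑ *
        ‖MvPowerSeries.coeff e (d.prod fun s n => a s ^ n)‖ₑ := by
    rw [MvPowerSeries.coeff_subst ha,
      finsum_eq_sum _ (MvPowerSeries.coeff_subst_finite ha f e)]
    refine (enorm_sum_le _ _).trans ?_
    simp only [smul_eq_mul, enorm_mul]
    exact ENNReal.sum_le_tsum _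
  calc weightedNorm ε (MvPowerSeries.subst a f)
      ≤ ∑' e : τ →₀ ℕ, ∑' d : σ →₀ ℕ, ‖MvPowerSeries.coeff d f‖ₑ *
        (‖MvPowerSeries.coeff e (d.prod fun s n => a s ^ n)‖ₑ * ∏ i, (ε i : ℝ≥0∞) ^ e i) := by
        refine ENNReal.tsum_le_tsum fun e => ?_
        simp_rw [← mul_assoc]
        rw [ENNReal.tsum_mul_right]
        gcongr
        exact key e
    _ = ∑' d : σ →₀ ℕ, ‖MvPowerSeries.coeff d f‖ₑ *
          weightedNorm ε (d.prod fun s n => a s ^ n) := by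
        rw [ENNReal.tsum_comm]
        simp_rw [ENNReal.tsum_mul_left]
        rfl
    _ ≤ weightedNorm δ f := by
        refine ENNReal.tsum_le_tsum fun d => ?_
        gcongr
        rw [Finsupp.prod_fintype _ _ (by simp)]
        refine (weightedNorm_prod_le _ _ _).trans ?_
        gcongr with i
        exact (weightedNorm_pow_le _ _ _).trans (by gcongr; exact h i)

/-- On a small enough polydisc the norms of the `a i` drop below radii at which `f` converges. -/
theorem IsConvergent.subst {a : σ → MvPowerSeries τ K} (ha : ∀ i, IsConvergent (a i))
    (h0 : ∀ i, MvPowerSeries.constantCoeff (a i) = 0) {f : MvPowerSeries σ K}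
    (hf : IsConvergent f) : IsConvergent (MvPowerSeries.subst a f) := by
  obtain ⟨δ, hδ, h⟩ := hf
  have : ∀ᶠ t : ℝ≥0 in 𝓝[>] 0, 0 < t ∧ ∀ i, weightedNorm (fun _ => t) (a i) ≤ δ i :=
    eventually_mem_nhdsWithin.and (eventually_all.2 fun i =>
      (ha i).eventually_weightedNorm_le (h0 i) (by simpa using hδ i))
  obtain ⟨t, ht, hta⟩ := this.exists
  exact ⟨fun _ => t, fun _ => ht,
    (weightedNorm_subst_le (MvPowerSeries.hasSubst_of_constantCoeff_zero h0) hta f).trans_lt h⟩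

/-! ### The order filtration -/

variable (σ K) in
/-- The ideal of the formal power series of order at least `N`. -/
def orderIdeal (N : ℕ) : Ideal (MvPowerSeries σ K) where
  carrier := {f | ∀ α, Finsupp.degree α < N → MvPowerSeries.coeff α f = 0}
  add_mem' {f g} hf hg α hα := by rw [map_add, hf α hα, hg α hα, add_zero]
  zero_mem' α _ := map_zero _
  smul_mem' c f hf α hα := by
    classical
    rw [smul_eq_mul, MvPowerSeries.coeff_mul]
    refine Finset.sum_eq_zero fun p hp => ?_
    rw [← Finset.HasAntidiagonal.mem_antidiagonal.1 hp, map_add] at hα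
    rw [hf _ (by omega), mul_zero]

theorem mem_orderIdeal {N : ℕ} {f : MvPowerSeries σ K} :
    f ∈ orderIdeal σ K N ↔ ∀ α, Finsupp.degree α < N → MvPowerSeries.coeff α f = 0 := Iff.rfl

theorem mul_mem_orderIdeal {M N : ℕ} {f g : MvPowerSeries σ K} (hf : f ∈ orderIdeal σ K M)
    (hg : g ∈ orderIdeal σ K N) : f * g ∈ orderIdeal σ K (M + N) := by
  classical
  intro α hα
  rw [MvPowerSeries.coeff_mul]
  refine Finset.sum_eq_zero fun p hp => ?_
  rw [← Finset.HasAntidiagonal.mem_antidiagonal.1 hp, map_add] at hα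
  by_cases h : Finsupp.degree p.1 < M
  · rw [hf _ h, zero_mul]
  · rw [hg _ (by omega), mul_zero]

theorem mem_orderIdeal_zero (f : MvPowerSeries σ K) : f ∈ orderIdeal σ K 0 := by
  intro α hα
  omega

theorem mem_orderIdeal_one {f : MvPowerSeries σ K} :
    f ∈ orderIdeal σ K 1 ↔ MvPowerSeries.constantCoeff f = 0 := by
  rw [mem_orderIdeal, ← MvPowerSeries.coeff_zero_eq_constantCoeff_apply]
  refine ⟨fun h => h 0 (by simp), fun h α hα => ?_⟩
  obtain rfl : α = 0 := by rwa [← Finsupp.degree_eq_zero_iff, ← Nat.lt_one_iff]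
  exact h

theorem eq_of_forall_sub_mem_orderIdeal {f g : MvPowerSeries σ K}
    (h : ∀ N, f - g ∈ orderIdeal σ K N) : f = g := by
  ext α
  rw [← sub_eq_zero, ← map_sub]
  exact h (Finsupp.degree α + 1) α (Nat.lt_succ_self _)

theorem orderIdeal_antitone {M N : ℕ} (h : M ≤ N) : orderIdeal σ K N ≤ orderIdeal σ K M :=
  fun _ hf α hα => hf α (hα.trans_le h)

/-- Telescoping: in each summand one factor is replaced by a difference of order `N`, and the other
`degree d - 1` factors have order at least one. -/
theorem prod_pow_sub_prod_pow_mem_orderIdeal {a b : σ → MvPowerSeries τ K}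
    (ha : ∀ i, a i ∈ orderIdeal τ K 1) (hb : ∀ i, b i ∈ orderIdeal τ K 1) {N : ℕ} (hN : 1 ≤ N)
    (hab : ∀ i, a i - b i ∈ orderIdeal τ K N) (d : σ →₀ ℕ) :
    (d.prod fun s n => a s ^ n) - (d.prod fun s n => b s ^ n) ∈
      orderIdeal τ K (N + Finsupp.degree d - 1) := by
  -- The orders of the two monomials themselves are needed in the induction step for `d + e`.
  let P (d : σ →₀ ℕ) : Prop := (d.prod fun s n => a s ^ n) ∈ orderIdeal τ K (Finsupp.degree d) ∧
    (d.prod fun s n => b s ^ n) ∈ orderIdeal τ K (Finsupp.degree d) ∧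
    (d.prod fun s n => a s ^ n) - (d.prod fun s n => b s ^ n) ∈
      orderIdeal τ K (N + Finsupp.degree d - 1)
  have hzero : P 0 := by
    refine ⟨mem_orderIdeal_zero _, mem_orderIdeal_zero _, ?_⟩
    simp only [Finsupp.prod_zero_index, sub_self, Submodule.zero_mem]
  have hadd (d e : σ →₀ ℕ) (hd : P d) (he : P e) : P (d + e) := by
    obtain ⟨h1, h2, h3⟩ := hd
    obtain ⟨h4, h5, h6⟩ := he
    have hprod (a : σ → MvPowerSeries τ K) : ((d + e).prod fun s n => a s ^ n) =
        (d.prod fun s n => a s ^ n) * (e.prod fun s n => a s ^ n) :=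
      Finsupp.prod_add_index' (by simp) (fun s m n => pow_add _ _ _)
    refine ⟨?_, ?_, ?_⟩
    · rw [hprod, map_add]
      exact mul_mem_orderIdeal h1 h4
    · rw [hprod, map_add]
      exact mul_mem_orderIdeal h2 h5
    · rw [hprod, hprod, map_add, show ∀ p q r s : MvPowerSeries τ K,
        p * q - r * s = (p - r) * q + r * (q - s) from fun p q r s => by ring]
      refine Ideal.add_mem _ ?_ ?_
      · refine orderIdeal_antitone ?_ (mul_mem_orderIdeal h3 h4)
        omega
      · refine orderIdeal_antitone ?_ (mul_mem_orderIdeal h2 h6)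
        omega
  suffices h : P d from h.2.2
  induction d using Finsupp.induction_linear with
  | zero => exact hzero
  | add d e hd he => exact hadd d e hd he
  | single i n =>
    induction n with
    | zero => simpa using hzero
    | succ n ih =>
      rw [Finsupp.single_add]
      refine hadd _ _ ih ⟨?_, ?_, ?_⟩
      · simpa [Finsupp.prod_single_index] using ha i
      · simpa [Finsupp.prod_single_index] using hb i
      · simpa [Finsupp.prod_single_index] using hab i

/-! ### The implicit function theorem -/

section ImplicitFunction

variable {κ : Type*} [Fintype κ]

theorem hasSubst_elim_X {ψ : κ → MvPowerSeries σ K} (h : ∀ i, ψ i ∈ orderIdeal σ K 1) :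
    MvPowerSeries.HasSubst (Sum.elim ψ MvPowerSeries.X) := by
  refine MvPowerSeries.hasSubst_of_constantCoeff_zero ?_
  rintro (i | i)
  · exact mem_orderIdeal_one.1 (h i)
  · exact MvPowerSeries.constantCoeff_X i

/-- The substitution `y ↦ ψ` in a power series in `(y, x)` with no terms linear in `y` is
contracting for the order filtration. -/
theorem subst_elim_sub_subst_elim_mem_orderIdeal {G : MvPowerSeries (κ ⊕ σ) K}
    (hG : ∀ j, MvPowerSeries.coeff (Finsupp.single (Sum.inl j) 1) G = 0)
    {ψ χ : κ → MvPowerSeries σ K} (hψ : ∀ i, ψ i ∈ orderIdeal σ K 1)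
    (hχ : ∀ i, χ i ∈ orderIdeal σ K 1) {N : ℕ} (hN : 1 ≤ N)
    (h : ∀ i, ψ i - χ i ∈ orderIdeal σ K N) :
    MvPowerSeries.subst (Sum.elim ψ MvPowerSeries.X) G -
      MvPowerSeries.subst (Sum.elim χ MvPowerSeries.X) G ∈ orderIdeal σ K (N + 1) := by
  intro e he
  rw [map_sub, sub_eq_zero, MvPowerSeries.coeff_subst (hasSubst_elim_X hψ),
    MvPowerSeries.coeff_subst (hasSubst_elim_X hχ)]
  refine finsum_congr fun d => ?_
  -- Constant terms and terms linear in `x` do not see `ψ` or `χ`, and terms linear in `y` are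
  -- absent. A monomial of degree at least 2 raises the order from `N` to `N + 2 - 1` or more.
  rcases Nat.lt_or_ge (Finsupp.degree d) 2 with hd | hd
  · rcases Nat.lt_or_ge (Finsupp.degree d) 1 with hd' | hd'
    · obtain rfl : d = 0 := by rwa [← Finsupp.degree_eq_zero_iff, ← Nat.lt_one_iff]
      simp
    · have hd1 : d ∈ {d : κ ⊕ σ →₀ ℕ | d.degree = 1} := le_antisymm (Nat.le_of_lt_succ hd) hd'
      rw [← Finsupp.range_single_one] at hd1
      obtain ⟨i | i, rfl⟩ := hd1
      · rw [hG, zero_smul, zero_smul]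
      · simp [Finsupp.prod_single_index]
  · congr 1
    rw [← sub_eq_zero, ← map_sub]
    refine prod_pow_sub_prod_pow_mem_orderIdeal (N := N) ?_ ?_ hN ?_ d e (by omega)
    · rintro (i | i)
      · exact hψ i
      · exact mem_orderIdeal_one.2 (MvPowerSeries.constantCoeff_X i)
    · rintro (i | i)
      · exact hχ i
      · exact mem_orderIdeal_one.2 (MvPowerSeries.constantCoeff_X i)
    · rintro (i | i)
      · exact h i
      · simp

/-- The approximations to the solution `y = ψ(x)` of `y = G(y, x)`. -/
def fixedPointSeq (G : κ → MvPowerSeries (κ ⊕ σ) K) : ℕ → κ → MvPowerSeries σ K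
  | 0 => 0
  | r + 1 => fun i =>
      MvPowerSeries.subst (Sum.elim (fixedPointSeq G r) MvPowerSeries.X) (G i)

/-- The formal solution `y = ψ(x)` of `y = G(y, x)`. -/
def fixedPoint (G : κ → MvPowerSeries (κ ⊕ σ) K) (i : κ) : MvPowerSeries σ K :=
  fun α => MvPowerSeries.coeff α (fixedPointSeq G (Finsupp.degree α + 1) i)

theorem coeff_of_fun (f : (σ →₀ ℕ) → K) (α : σ →₀ ℕ) :
    MvPowerSeries.coeff α (show MvPowerSeries σ K from f) = f α := rfl

theorem coeff_fixedPoint (G : κ → MvPowerSeries (κ ⊕ σ) K) (i : κ) (α : σ →₀ ℕ) :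
    MvPowerSeries.coeff α (fixedPoint G i) =
      MvPowerSeries.coeff α (fixedPointSeq G (Finsupp.degree α + 1) i) :=
  coeff_of_fun (fun α => MvPowerSeries.coeff α (fixedPointSeq G (Finsupp.degree α + 1) i)) α

variable {G : κ → MvPowerSeries (κ ⊕ σ) K} (h0 : ∀ i, MvPowerSeries.constantCoeff (G i) = 0)
  (h1 : ∀ i j, MvPowerSeries.coeff (Finsupp.single (Sum.inl j) 1) (G i) = 0)

include h0 in
theorem fixedPointSeq_mem_orderIdeal (r : ℕ) (i : κ) :
    fixedPointSeq G r i ∈ orderIdeal σ K 1 := by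
  induction r generalizing i with
  | zero => exact Ideal.zero_mem _
  | succ r ih =>
    rw [mem_orderIdeal_one]
    refine MvPowerSeries.constantCoeff_subst_eq_zero (hasSubst_elim_X ih) ?_ (h0 i)
    rintro (j | j)
    · exact mem_orderIdeal_one.1 (ih j)
    · exact MvPowerSeries.constantCoeff_X j

include h0 h1 in
theorem fixedPointSeq_succ_sub_mem_orderIdeal (r : ℕ) (i : κ) :
    fixedPointSeq G (r + 1) i - fixedPointSeq G r i ∈ orderIdeal σ K (r + 1) := by
  induction r generalizing i with
  | zero =>
    exact Ideal.sub_mem _ (fixedPointSeq_mem_orderIdeal h0 _ _)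
      (fixedPointSeq_mem_orderIdeal h0 _ _)
  | succ r ih =>
    exact subst_elim_sub_subst_elim_mem_orderIdeal (h1 i) (fixedPointSeq_mem_orderIdeal h0 _)
      (fixedPointSeq_mem_orderIdeal h0 _) (by omega) ih

include h0 h1 in
-- Iterates `r` and `r + 1` agree below degree `r + 1`, so the coefficient at `α` is constant once
-- `r` exceeds the degree of `α`.
theorem fixedPoint_sub_fixedPointSeq_mem_orderIdeal (r : ℕ) (i : κ) :
    fixedPoint G i - fixedPointSeq G r i ∈ orderIdeal σ K r := by
  intro α hα
  have key (s : ℕ) : fixedPointSeq G (Finsupp.degree α + 1 + s) i -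
      fixedPointSeq G (Finsupp.degree α + 1) i ∈ orderIdeal σ K (Finsupp.degree α + 1) := by
    induction s with
    | zero => simp
    | succ s ih =>
      have := orderIdeal_antitone (show Finsupp.degree α + 1 ≤ Finsupp.degree α + 1 + s + 1 by omega)
        (fixedPointSeq_succ_sub_mem_orderIdeal h0 h1 (Finsupp.degree α + 1 + s) i)
      simpa [add_assoc] using Ideal.add_mem _ this ih
  obtain ⟨s, rfl⟩ := Nat.exists_eq_add_of_le (Nat.succ_le_of_lt hα)
  have := key s α (Nat.lt_succ_self _)
  rw [map_sub, sub_eq_zero] at this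
  rw [map_sub, sub_eq_zero, coeff_fixedPoint]
  exact this.symm

include h0 h1 in
theorem fixedPoint_mem_orderIdeal (i : κ) : fixedPoint G i ∈ orderIdeal σ K 1 := by
  have := Ideal.add_mem _ (fixedPoint_sub_fixedPointSeq_mem_orderIdeal h0 h1 1 i)
    (fixedPointSeq_mem_orderIdeal h0 1 i)
  simpa using this

include h0 h1 in
-- By contraction, both sides agree with the iterate of index `N + 2` up to order `N + 2`, for every
-- `N`.
theorem fixedPoint_eq_subst (i : κ) :
    fixedPoint G i = MvPowerSeries.subst (Sum.elim (fixedPoint G) MvPowerSeries.X) (G i) := by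
  refine eq_of_forall_sub_mem_orderIdeal fun N => ?_
  have e1 := fixedPoint_sub_fixedPointSeq_mem_orderIdeal h0 h1 (N + 1 + 1) i
  have e2 := subst_elim_sub_subst_elim_mem_orderIdeal (h1 i) (fixedPoint_mem_orderIdeal h0 h1)
    (fixedPointSeq_mem_orderIdeal h0 (N + 1)) (Nat.succ_pos N)
    (fixedPoint_sub_fixedPointSeq_mem_orderIdeal h0 h1 (N + 1))
  have := Ideal.sub_mem _ e1 e2
  rw [fixedPointSeq, sub_sub_sub_cancel_right] at this
  exact orderIdeal_antitone (by omega) this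

include h0 h1 in
-- Give `y` weight 1 and `x` weight 2. Then `G` has no terms of weight below 2, so on the polydisc
-- of radii `t` in `y` and `t ^ 2` in `x` its norm is `O(t ^ 2)`, hence at most `t` for small `t`.
-- By induction all iterates have norm at most `t` at radius `t ^ 2`.
theorem isConvergent_fixedPoint (hG : ∀ i, IsConvergent (G i)) (i : κ) :
    IsConvergent (fixedPoint G i) := by
  let w : κ ⊕ σ → ℕ := Sum.elim (fun _ => 1) (fun _ => 2)
  have hw : ∀ i, 1 ≤ w i := by rintro (i | i) <;> simp [w]
  have hN (i : κ) (d : κ ⊕ σ →₀ ℕ) (hd : Finsupp.weight w d < 2) :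
      MvPowerSeries.coeff d (G i) = 0 := by
    have hdeg : Finsupp.degree d ≤ Finsupp.weight w d := by
      rw [Finsupp.degree_eq_sum, Finsupp.weight_eq_sum]
      exact Finset.sum_le_sum fun j _ => Nat.le_mul_of_pos_right _ (hw j)
    rcases Nat.lt_or_ge (Finsupp.degree d) 1 with hd' | hd'
    · obtain rfl : d = 0 := by rwa [← Finsupp.degree_eq_zero_iff, ← Nat.lt_one_iff]
      simpa using h0 i
    · have hd1 : d ∈ {d : κ ⊕ σ →₀ ℕ | d.degree = 1} := le_antisymm (by omega) hd'
      rw [← Finsupp.range_single_one] at hd1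
      obtain ⟨j | j, rfl⟩ := hd1
      · exact h1 i j
      · simp [w, Finsupp.weight_single] at hd
  choose C hC hCt using fun i => (hG i).exists_weightedNorm_le hw (hN i)
  have hev : ∀ᶠ t : ℝ≥0 in 𝓝[>] 0, 0 < t ∧
      ∀ i, weightedNorm (fun j => t ^ w j) (G i) ≤ t := by
    refine eventually_mem_nhdsWithin.and (eventually_all.2 fun i => ?_)
    filter_upwards [hCt i, eventually_mul_coe_le (hC i) one_pos] with t ht1 ht2
    refine ht1.trans ?_
    rw [pow_two, ← mul_assoc]
    exact mul_le_of_le_one_left zero_le ht2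
  obtain ⟨t, ht, htG⟩ := hev.exists
  have hseq (r : ℕ) (i : κ) : weightedNorm (fun _ => t ^ 2) (fixedPointSeq G r i) ≤ t := by
    induction r generalizing i with
    | zero => simp [fixedPointSeq, weightedNorm]
    | succ r ih =>
      refine (weightedNorm_subst_le (δ := fun j => t ^ w j)
        (hasSubst_elim_X (fixedPointSeq_mem_orderIdeal h0 r)) ?_ (G i)).trans (htG i)
      rintro (j | j)
      · simpa [w] using ih j
      · simp [w, weightedNorm_X]
  refine ⟨fun _ => t ^ 2, fun _ => pow_pos ht 2, lt_of_le_of_lt ?_ (ENNReal.coe_lt_top (r := t))⟩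
  rw [weightedNorm, ENNReal.tsum_eq_iSup_sum]
  refine iSup_le fun s => ?_
  -- A finite partial sum of the norm of the fixed point is also one for an iterate whose index
  -- exceeds all degrees involved; this replaces a limit argument.
  refine le_trans ?_ (hseq (s.sup Finsupp.degree + 1) i)
  refine le_trans (le_of_eq (Finset.sum_congr rfl fun α hα => ?_)) (ENNReal.sum_le_tsum s)
  have := fixedPoint_sub_fixedPointSeq_mem_orderIdeal h0 h1 (s.sup Finsupp.degree + 1) i α
    (Nat.lt_succ_of_le (Finset.le_sup hα))
  rw [map_sub, sub_eq_zero] at this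
  rw [this]

end ImplicitFunction

namespace ConvSeries

/-! ### Substitution homomorphisms -/

/-- Substitution of convergent power series without constant terms for the variables. -/
def evalHom (a : σ → MvPowerSeries τ K) (ha : ∀ i, IsConvergent (a i))
    (h0 : ∀ i, MvPowerSeries.constantCoeff (a i) = 0) : ConvSeries σ K →ₐ[K] ConvSeries τ K :=
  ((MvPowerSeries.substAlgHom (R := K)
    (MvPowerSeries.hasSubst_of_constantCoeff_zero h0)).comp (ConvSeries σ K).val).codRestrict
    (ConvSeries τ K) (by
      rintro ⟨f, hf⟩
      have h := MvPowerSeries.hasSubst_of_constantCoeff_zero h0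
      change IsConvergent (MvPowerSeries.substAlgHom h f)
      rw [MvPowerSeries.substAlgHom_apply]
      exact hf.subst ha h0)

theorem coe_evalHom (a : σ → MvPowerSeries τ K) (ha : ∀ i, IsConvergent (a i))
    (h0 : ∀ i, MvPowerSeries.constantCoeff (a i) = 0) (f : ConvSeries σ K) :
    (evalHom a ha h0 f : MvPowerSeries τ K) = MvPowerSeries.subst a (f : MvPowerSeries σ K) :=
  MvPowerSeries.substAlgHom_apply (MvPowerSeries.hasSubst_of_constantCoeff_zero h0) _

theorem evalHom_X (a : σ → MvPowerSeries τ K) (ha : ∀ i, IsConvergent (a i))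
    (h0 : ∀ i, MvPowerSeries.constantCoeff (a i) = 0) (i : σ) :
    (evalHom a ha h0 (X K i) : MvPowerSeries τ K) = a i := by
  rw [coe_evalHom]
  exact MvPowerSeries.subst_X (MvPowerSeries.hasSubst_of_constantCoeff_zero h0) i

theorem coe_incl (e : σ ↪ τ) (f : ConvSeries σ K) :
    (incl e f : MvPowerSeries τ K) = MvPowerSeries.rename e (f : MvPowerSeries σ K) := rfl

theorem coe_X (i : σ) : ((X K i : ConvSeries σ K) : MvPowerSeries σ K) = MvPowerSeries.X i := rfl

@[simp]
theorem incl_X (e : σ ↪ τ) (i : σ) : incl e (X K i) = X K (e i) :=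
  Subtype.ext (MvPowerSeries.rename_X e i)

theorem coe_evalHom_incl {υ : Type*} [Fintype υ] (e : υ ↪ σ) (a : σ → MvPowerSeries τ K)
    (ha : ∀ i, IsConvergent (a i)) (h0 : ∀ i, MvPowerSeries.constantCoeff (a i) = 0)
    (f : ConvSeries υ K) :
    (evalHom a ha h0 (incl e f) : MvPowerSeries τ K) =
      MvPowerSeries.subst (fun i => a (e i)) (f : MvPowerSeries υ K) := by
  have h := MvPowerSeries.hasSubst_of_constantCoeff_zero h0
  rw [coe_evalHom, coe_incl, MvPowerSeries.rename_eq_subst,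
    MvPowerSeries.subst_comp_subst_apply (MvPowerSeries.HasSubst.X_comp _) h]
  congr 1
  funext i
  exact MvPowerSeries.subst_X h (e i)

/-! ### Constant coefficients and derivatives at the origin -/

/-- The constant coefficient of a convergent power series. -/
def constCoeff : ConvSeries σ K →ₐ[K] K where
  toRingHom := (MvPowerSeries.constantCoeff (σ := σ) (R := K)).comp
    (ConvSeries σ K).val.toRingHom
  commutes' r := by
    change MvPowerSeries.constantCoeff (algebraMap K (MvPowerSeries σ K) r) = r
    rw [MvPowerSeries.algebraMap_apply, MvPowerSeries.constantCoeff_C]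
    rfl

theorem constCoeff_apply (f : ConvSeries σ K) :
    constCoeff f = MvPowerSeries.constantCoeff (f : MvPowerSeries σ K) := rfl

@[simp]
theorem constCoeff_X (i : σ) : constCoeff (X K i : ConvSeries σ K) = 0 :=
  MvPowerSeries.constantCoeff_X i

@[simp]
theorem constCoeff_incl (e : σ ↪ τ) (f : ConvSeries σ K) :
    constCoeff (incl e f) = constCoeff f :=
  MvPowerSeries.constantCoeff_rename e (f : MvPowerSeries σ K)

/-- The first partial derivative at the origin. -/
def lin (p : σ) : ConvSeries σ K →ₗ[K] K where
  toFun f := MvPowerSeries.constantCoeff (MvPowerSeries.pderiv K p (f : MvPowerSeries σ K))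
  map_add' f g := by simp
  map_smul' c f := by simp

/-- The second partial derivative at the origin. -/
def hess (p q : σ) : ConvSeries σ K →ₗ[K] K where
  toFun f := MvPowerSeries.constantCoeff (MvPowerSeries.pderiv K p
    (MvPowerSeries.pderiv K q (f : MvPowerSeries σ K)))
  map_add' f g := by simp
  map_smul' c f := by simp

theorem lin_apply (p : σ) (f : ConvSeries σ K) : lin p f =
    MvPowerSeries.constantCoeff (MvPowerSeries.pderiv K p (f : MvPowerSeries σ K)) := rfl

theorem hess_apply (p q : σ) (f : ConvSeries σ K) : hess p q f =
    MvPowerSeries.constantCoeff (MvPowerSeries.pderiv K p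
      (MvPowerSeries.pderiv K q (f : MvPowerSeries σ K))) := rfl

theorem lin_eq_coeff (p : σ) (f : ConvSeries σ K) :
    lin p f = MvPowerSeries.coeff (Finsupp.single p 1) (f : MvPowerSeries σ K) := by
  rw [lin_apply, ← MvPowerSeries.coeff_zero_eq_constantCoeff_apply, MvPowerSeries.coeff_pderiv]
  simp

theorem lin_mul (p : σ) (f g : ConvSeries σ K) :
    lin p (f * g) = constCoeff f * lin p g + constCoeff g * lin p f := by
  simp [lin_apply, constCoeff_apply]

theorem hess_mul (p q : σ) {f g : ConvSeries σ K} (hf : constCoeff f = 0) (hg : constCoeff g = 0) :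
    hess p q (f * g) = lin p f * lin q g + lin q f * lin p g := by
  rw [constCoeff_apply] at hf hg
  simp [lin_apply, hess_apply, hf, hg]
  ring

@[simp]
theorem lin_algebraMap (p : σ) (c : K) : lin p (algebraMap K (ConvSeries σ K) c) = 0 := by
  have : ((algebraMap K (ConvSeries σ K) c : ConvSeries σ K) : MvPowerSeries σ K) =
    MvPowerSeries.C c := rfl
  simp [lin_apply, this]

@[simp]
theorem hess_algebraMap (p q : σ) (c : K) :
    hess p q (algebraMap K (ConvSeries σ K) c) = 0 := by
  have : ((algebraMap K (ConvSeries σ K) c : ConvSeries σ K) : MvPowerSeries σ K) =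
    MvPowerSeries.C c := rfl
  simp [hess_apply, this]

theorem lin_X [DecidableEq σ] (p i : σ) :
    lin p (X K i : ConvSeries σ K) = if p = i then 1 else 0 := by
  rw [lin_eq_coeff, coe_X, MvPowerSeries.coeff_index_single_X]

theorem lin_incl (e : σ ↪ τ) (p : σ) (f : ConvSeries σ K) :
    lin (e p) (incl e f) = lin p f := by
  have := MvPowerSeries.coeff_embDomain_rename e (f : MvPowerSeries σ K) (Finsupp.single p 1)
  rw [Finsupp.embDomain_single] at this
  rw [lin_eq_coeff, lin_eq_coeff, coe_incl, this]

theorem lin_incl_of_notMem_range (e : σ ↪ τ) {p : τ} (hp : p ∉ Set.range e)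
    (f : ConvSeries σ K) : lin p (incl e f) = 0 := by
  rw [lin_eq_coeff, coe_incl, MvPowerSeries.coeff_rename_eq_zero]
  rintro ⟨α, hα⟩
  apply hp
  by_contra h
  have h2 := Finsupp.mapDomain_of_notMem_range (f := e) α p h
  rw [hα] at h2
  simp at h2

/-! ### The implicit function theorem in normal form, units, and locality -/

/-- `S` is the substitution `y = ψ(x)`. As an algebra homomorphism fixing `x` it can be used without
reference to `ψ`. -/
theorem exists_algHom_of_fixedPoint {κ : Type*} [Fintype κ] (G : κ → ConvSeries (κ ⊕ σ) K)
    (h0 : ∀ i, constCoeff (G i) = 0) (h1 : ∀ i j, lin (Sum.inl j) (G i) = 0) :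
    ∃ S : ConvSeries (κ ⊕ σ) K →ₐ[K] ConvSeries σ K,
      (∀ i, S (X K (Sum.inl i)) = S (G i)) ∧
      ∀ f, S (incl Function.Embedding.inr f) = f := by
  have h0' (i) : MvPowerSeries.constantCoeff (G i : MvPowerSeries (κ ⊕ σ) K) = 0 := h0 i
  have h1' (i j) : MvPowerSeries.coeff (Finsupp.single (Sum.inl j) 1)
      (G i : MvPowerSeries (κ ⊕ σ) K) = 0 := by rw [← lin_eq_coeff, h1]
  have hψ := isConvergent_fixedPoint h0' h1' fun i => (G i).2
  have hψ0 := fixedPoint_mem_orderIdeal h0' h1'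
  refine ⟨evalHom (Sum.elim (fixedPoint fun i => (G i : MvPowerSeries (κ ⊕ σ) K)) MvPowerSeries.X)
    ?_ ?_, fun i => ?_, fun f => ?_⟩
  · rintro (i | i)
    · exact hψ i
    · exact (X K i).2
  · rintro (i | i)
    · exact mem_orderIdeal_one.1 (hψ0 i)
    · exact MvPowerSeries.constantCoeff_X i
  · refine Subtype.ext ?_
    rw [evalHom_X, coe_evalHom]
    exact fixedPoint_eq_subst h0' h1' i
  · refine Subtype.ext ?_
    rw [coe_evalHom_incl]
    change MvPowerSeries.subst MvPowerSeries.X (f : MvPowerSeries σ K) = _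
    rw [MvPowerSeries.subst_self, id]

/-- The inverse is `1 + v` with `v = u (1 + v)`, a fixed point equation whose coefficient of `v`
vanishes at the origin. -/
theorem isUnit_one_sub {u : ConvSeries σ K} (hu : constCoeff u = 0) : IsUnit (1 - u) := by
  obtain ⟨S, hS, hS'⟩ := exists_algHom_of_fixedPoint (κ := Unit)
    (fun _ => incl Function.Embedding.inr u * (1 + X K (Sum.inl ())))
    (fun _ => by rw [map_mul, constCoeff_incl, hu, zero_mul])
    (fun _ _ => by
      rw [lin_mul, constCoeff_incl, hu, lin_incl_of_notMem_range _ (by simp)]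
      ring)
  have h := hS ()
  rw [map_mul, hS', map_add, map_one] at h
  refine IsUnit.of_mul_eq_one (1 + S (X K (Sum.inl ()))) ?_
  linear_combination h

theorem isUnit_of_constCoeff_ne_zero {f : ConvSeries σ K} (hf : constCoeff f ≠ 0) : IsUnit f := by
  have h : f = algebraMap K _ (constCoeff f) *
      (1 - (1 - algebraMap K _ (constCoeff f)⁻¹ * f)) := by
    rw [sub_sub_cancel, ← mul_assoc, ← map_mul, mul_inv_cancel₀ hf, map_one, one_mul]
  rw [h]
  refine ((isUnit_iff_ne_zero.2 hf).map (algebraMap K _)).mul (isUnit_one_sub ?_)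
  rw [map_sub, map_one, map_mul, AlgHom.commutes, Algebra.algebraMap_self_apply,
    inv_mul_cancel₀ hf, sub_self]

/-- A homomorphism between algebras of convergent power series preserves constant
coefficients. -/
@[simp]
theorem constCoeff_algHom (φ : ConvSeries σ K →ₐ[K] ConvSeries τ K) (f : ConvSeries σ K) :
    constCoeff (φ f) = constCoeff f := by
  by_contra h
  -- Were the constant coefficients different, this difference would be a unit, but its image has
  -- constant coefficient zero.
  have h1 : constCoeff (f - algebraMap K _ (constCoeff (φ f))) ≠ 0 := by
    rw [map_sub, AlgHom.commutes, Algebra.algebraMap_self_apply]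
    exact sub_ne_zero.2 (Ne.symm h)
  have h2 := ((isUnit_of_constCoeff_ne_zero h1).map φ).map (constCoeff (σ := τ) (K := K))
  rw [map_sub, map_sub, AlgHom.commutes, AlgHom.commutes, Algebra.algebraMap_self_apply,
    sub_self] at h2
  exact not_isUnit_zero h2

/-! ### Division by the variables -/

/-- A choice of a variable that occurs in a given nontrivial monomial. -/
def someVar (α : σ →₀ ℕ) : Option σ := by
  classical
  exact if h : ∃ i, α i ≠ 0 then some h.choose else none

theorem apply_ne_zero_of_someVar_eq {α : σ →₀ ℕ} {i : σ} (h : someVar α = some i) : α i ≠ 0 := by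
  unfold someVar at h
  split_ifs at h with h'
  rw [Option.some.injEq] at h
  exact h ▸ h'.choose_spec

theorem exists_someVar_eq {α : σ →₀ ℕ} (h : α ≠ 0) : ∃ i, someVar α = some i := by
  have h' : ∃ i, α i ≠ 0 := by
    by_contra! h'
    exact h (Finsupp.ext h')
  exact ⟨h'.choose, by rw [someVar, dif_pos h']⟩

open Classical in
/-- The quotients in a division of `f - f(0)` by the variables. -/
def divVar (f : MvPowerSeries σ K) (i : σ) : MvPowerSeries σ K :=
  fun β => if someVar (β + Finsupp.single i 1) = some i then
    MvPowerSeries.coeff (β + Finsupp.single i 1) f else 0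

open Classical in
theorem coeff_divVar (f : MvPowerSeries σ K) (i : σ) (β : σ →₀ ℕ) :
    MvPowerSeries.coeff β (divVar f i) = if someVar (β + Finsupp.single i 1) = some i then
      MvPowerSeries.coeff (β + Finsupp.single i 1) f else 0 := rfl

/-- Multiplication by `x_i` embeds the terms of the quotient among those of `f`, at the cost of a
factor `ε i` in the norm. -/
theorem isConvergent_divVar {f : MvPowerSeries σ K} (hf : IsConvergent f) (i : σ) :
    IsConvergent (divVar f i) := by
  classical
  obtain ⟨ε, hε, h⟩ := hf
  refine ⟨ε, hε, ?_⟩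
  have hle : weightedNorm ε (divVar f i) * ε i ≤ weightedNorm ε f := by
    unfold weightedNorm
    rw [← ENNReal.tsum_mul_right]
    refine le_trans (ENNReal.tsum_le_tsum fun β => ?_)
      (ENNReal.tsum_comp_le_tsum_of_injective (f := fun β : σ →₀ ℕ => β + Finsupp.single i 1)
        (add_left_injective _) _)
    rw [coeff_divVar, mul_assoc]
    have : (∏ j, (ε j : ℝ≥0∞) ^ β j) * ε i = ∏ j, (ε j : ℝ≥0∞) ^ (β + Finsupp.single i 1 : σ →₀ ℕ) j := by
      simp_rw [Finsupp.add_apply, pow_add, Finset.prod_mul_distrib]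
      congr 1
      rw [Finset.prod_eq_single i] <;> simp +contextual [eq_comm]
    rw [this]
    gcongr
    split_ifs <;> simp
  exact ENNReal.lt_top_of_mul_ne_top_left (hle.trans_lt h).ne (by simpa using (hε i).ne')

/-- `someVar` assigns each nontrivial monomial to exactly one variable, so every coefficient is
counted once. -/
theorem eq_C_add_sum_X_mul_divVar (f : MvPowerSeries σ K) :
    f = MvPowerSeries.C (MvPowerSeries.constantCoeff f) +
      ∑ i, MvPowerSeries.X i * divVar f i := by
  classical
  ext α
  have hterm (i : σ) : MvPowerSeries.coeff α (MvPowerSeries.X i * divVar f i) =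
      if someVar α = some i then MvPowerSeries.coeff α f else 0 := by
    rw [MvPowerSeries.X, MvPowerSeries.coeff_monomial_mul, one_mul, coeff_divVar]
    by_cases h : Finsupp.single i 1 ≤ α
    · rw [if_pos h, tsub_add_cancel_of_le h]
    · rw [if_neg h, if_neg]
      intro h'
      exact h (Finsupp.single_le_iff.2 (Nat.one_le_iff_ne_zero.2 (apply_ne_zero_of_someVar_eq h')))
  rw [map_add, map_sum, Finset.sum_congr rfl fun i _ => hterm i, MvPowerSeries.coeff_C]
  by_cases hα : α = 0
  · subst hα
    rw [if_pos rfl, Finset.sum_eq_zero, add_zero, MvPowerSeries.coeff_zero_eq_constantCoeff_apply]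
    intro i _
    rw [if_neg]
    intro h
    exact apply_ne_zero_of_someVar_eq h rfl
  · obtain ⟨i, hi⟩ := exists_someVar_eq hα
    simp [hi, hα]

/-- A finite algebraic identity, so any algebra homomorphism can be applied to it; the chain rules
below rest on this. -/
theorem exists_eq_algebraMap_add_sum (f : ConvSeries σ K) :
    ∃ g : σ → ConvSeries σ K,
      f = algebraMap K _ (constCoeff f) + ∑ i, X K i * g i := by
  refine ⟨fun i => ⟨divVar f i, isConvergent_divVar f.2 i⟩, Subtype.ext ?_⟩
  rw [AddMemClass.coe_add, AddSubmonoidClass.coe_finsetSum]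
  exact eq_C_add_sum_X_mul_divVar (f : MvPowerSeries σ K)

/-- A homomorphism between algebras of convergent power series is determined by the images of
the variables. -/
theorem algHom_ext {φ ψ : ConvSeries σ K →ₐ[K] ConvSeries τ K}
    (h : ∀ i, φ (X K i) = ψ (X K i)) : φ = ψ := by
  ext1 f
  refine Subtype.ext (eq_of_forall_sub_mem_orderIdeal fun N => ?_)
  rw [← AddSubgroupClass.coe_sub]
  -- Each division by the variables gains one order, because the images of the variables have no
  -- constant term.
  induction N generalizing f with
  | zero => exact mem_orderIdeal_zero _
  | succ N ih =>
    obtain ⟨g, hg⟩ := exists_eq_algebraMap_add_sum f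
    have : φ f - ψ f = ∑ i, φ (X K i) * (φ (g i) - ψ (g i)) := by
      rw [hg]
      simp only [map_add, map_sum, map_mul, AlgHom.commutes, h, add_sub_add_left_eq_sub, mul_sub,
        Finset.sum_sub_distrib]
    rw [this, AddSubmonoidClass.coe_finsetSum]
    refine Ideal.sum_mem _ fun i _ => ?_
    rw [add_comm]
    refine mul_mem_orderIdeal (mem_orderIdeal_one.2 ?_) (ih (g i))
    rw [← constCoeff_apply, constCoeff_algHom, constCoeff_X]

theorem coe_mem_orderIdeal_of_mem_maxIdeal_pow {N : ℕ} {f : ConvSeries σ K}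
    (hf : f ∈ maxIdeal σ K ^ N) : (f : MvPowerSeries σ K) ∈ orderIdeal σ K N := by
  induction N generalizing f with
  | zero => exact mem_orderIdeal_zero _
  | succ N ih =>
    rw [pow_succ] at hf
    induction hf using Submodule.mul_induction_on' with
    | mem_mul_mem g hg u hu =>
      refine mul_mem_orderIdeal (ih hg) ?_
      have hle : maxIdeal σ K ≤ (orderIdeal σ K 1).comap (ConvSeries σ K).val.toRingHom := by
        rw [maxIdeal, Ideal.span_le]
        rintro _ ⟨i, rfl⟩
        exact mem_orderIdeal_one.2 (MvPowerSeries.constantCoeff_X i)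
      exact hle hu
    | add g _ u _ hg hu => exact Ideal.add_mem _ hg hu

theorem lin_eq_zero_of_mem_maxIdeal_pow {f : ConvSeries σ K} (hf : f ∈ maxIdeal σ K ^ 3) (p : σ) :
    lin p f = 0 := by
  rw [lin_eq_coeff]
  exact coe_mem_orderIdeal_of_mem_maxIdeal_pow hf _ (by simp)

theorem hess_eq_zero_of_mem_maxIdeal_pow {f : ConvSeries σ K} (hf : f ∈ maxIdeal σ K ^ 3)
    (p q : σ) : hess p q f = 0 := by
  rw [hess_apply, ← MvPowerSeries.coeff_zero_eq_constantCoeff_apply, MvPowerSeries.coeff_pderiv,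
    MvPowerSeries.coeff_pderiv, coe_mem_orderIdeal_of_mem_maxIdeal_pow hf _ (by simp)]
  simp

/-! ### Jacobian and Hessian matrices -/

variable {υ : Type*} [Fintype υ]

/-- The Jacobian matrix at the origin of a homomorphism between algebras of convergent power
series. -/
def jacobian (φ : ConvSeries σ K →ₐ[K] ConvSeries τ K) : Matrix σ τ K :=
  Matrix.of fun i p => lin p (φ (X K i))

/-- The Hessian matrix at the origin of a convergent power series. -/
def hessian (f : ConvSeries σ K) : Matrix σ σ K := Matrix.of fun p q => hess p q f

theorem jacobian_apply (φ : ConvSeries σ K →ₐ[K] ConvSeries τ K) (i : σ) (p : τ) :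
    jacobian φ i p = lin p (φ (X K i)) := rfl

theorem hessian_apply (f : ConvSeries σ K) (p q : σ) : hessian f p q = hess p q f := rfl

theorem hessian_add (f g : ConvSeries σ K) : hessian (f + g) = hessian f + hessian g := by
  ext p q
  simp [hessian_apply]

/-- The chain rule for first derivatives at the origin. -/
theorem lin_algHom (φ : ConvSeries σ K →ₐ[K] ConvSeries τ K) (p : τ) (f : ConvSeries σ K) :
    lin p (φ f) = ∑ i, lin i f * jacobian φ i p := by
  classical
  obtain ⟨g, hg⟩ := exists_eq_algebraMap_add_sum f
  have h (i : σ) : lin i f = constCoeff (g i) := by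
    conv_lhs => rw [hg]
    simp [lin_mul, lin_X]
  conv_lhs => rw [hg]
  simp [lin_mul, h, jacobian_apply]

theorem jacobian_comp (ψ : ConvSeries τ K →ₐ[K] ConvSeries υ K)
    (φ : ConvSeries σ K →ₐ[K] ConvSeries τ K) :
    jacobian (ψ.comp φ) = jacobian φ * jacobian ψ := by
  ext i p
  rw [Matrix.mul_apply, jacobian_apply, AlgHom.comp_apply, lin_algHom]
  rfl

theorem jacobian_id [DecidableEq σ] : jacobian (AlgHom.id K (ConvSeries σ K)) = 1 := by
  ext i p
  rw [jacobian_apply, AlgHom.id_apply, lin_X, Matrix.one_apply]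
  simp only [eq_comm]

/-- The chain rule for second derivatives at the origin of a power series without linear terms. -/
theorem hessian_algHom (φ : ConvSeries σ K →ₐ[K] ConvSeries τ K) {f : ConvSeries σ K}
    (hf : ∀ i, lin i f = 0) :
    hessian (φ f) = (jacobian φ).transpose * hessian f * jacobian φ := by
  classical
  obtain ⟨g, hg⟩ := exists_eq_algebraMap_add_sum f
  -- Without linear terms `f` is, up to a constant, `∑ x_i g_i` with `g_i(0) = 0`. The product rule
  -- then involves only first derivatives, so second derivatives of `φ` do not enter.
  have hg0 (i : σ) : constCoeff (g i) = 0 := by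
    rw [← hf i]
    conv_rhs => rw [hg]
    simp [lin_mul, lin_X]
  have h1 (p q : σ) : hess p q f = lin q (g p) + lin p (g q) := by
    conv_lhs => rw [hg]
    simp [hess_mul, lin_X, hg0, Finset.sum_add_distrib]
  have h2 (p q : τ) : hess p q (φ f) =
      ∑ i, (jacobian φ i p * lin q (φ (g i)) + jacobian φ i q * lin p (φ (g i))) := by
    conv_lhs => rw [hg]
    simp [hess_mul, hg0, jacobian_apply]
  ext p q
  rw [hessian_apply, h2, Matrix.mul_assoc, Matrix.mul_apply]
  simp_rw [Matrix.mul_apply, Matrix.transpose_apply, hessian_apply, h1, lin_algHom, add_mul,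
    Finset.sum_add_distrib, mul_add]
  rw [Finset.sum_add_distrib]
  congr 1
  simp_rw [Finset.mul_sum]
  rw [Finset.sum_comm]
  exact Finset.sum_congr rfl fun i _ => Finset.sum_congr rfl fun j _ => by ring

/-! ### The implicit and the inverse function theorem -/

/-- The implicit function theorem: a system `F(y, x) = 0` with invertible Jacobian matrix with
respect to `y` can be solved for `y`. -/
theorem exists_algHom_of_isUnit_jacobian {κ : Type*} [Fintype κ] [DecidableEq κ]
    (F : κ → ConvSeries (κ ⊕ σ) K) (h0 : ∀ i, constCoeff (F i) = 0)
    (h1 : IsUnit (Matrix.of fun i j => lin (Sum.inl j) (F i))) :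
    ∃ S : ConvSeries (κ ⊕ σ) K →ₐ[K] ConvSeries σ K,
      (∀ i, S (F i) = 0) ∧ ∀ f, S (incl Function.Embedding.inr f) = f := by
  classical
  set A : Matrix κ κ K := Matrix.of fun i j => lin (Sum.inl j) (F i) with hA
  have hdet := (Matrix.isUnit_iff_isUnit_det A).1 h1
  -- The equation `y = y - A⁻¹ F` is equivalent to `F = 0`, and its right-hand side has no terms
  -- linear in `y`.
  obtain ⟨S, hS, hS'⟩ := exists_algHom_of_fixedPoint
    (fun i => X K (Sum.inl i) - ∑ j, A⁻¹ i j • F j)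
    (fun i => by simp [h0])
    (fun i j => by
      have : ∑ k, A⁻¹ i k * lin (Sum.inl j) (F k) = (A⁻¹ * A) i j := by
        rw [Matrix.mul_apply]
        rfl
      rw [map_sub, map_sum, lin_X]
      simp_rw [map_smul, smul_eq_mul]
      rw [this, Matrix.nonsing_inv_mul _ hdet, Matrix.one_apply]
      simp [eq_comm])
  refine ⟨S, fun i => ?_, hS'⟩
  have h (i : κ) : ∑ j, A⁻¹ i j • S (F j) = 0 := by
    have := hS i
    rw [map_sub, map_sum] at this
    simp_rw [map_smul] at this
    linear_combination this
  have h2 : ∑ k, A i k • ∑ j, A⁻¹ k j • S (F j) = S (F i) := by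
    simp_rw [Finset.smul_sum, smul_smul]
    rw [Finset.sum_comm]
    simp_rw [← Finset.sum_smul, ← Matrix.mul_apply]
    simp [Matrix.mul_nonsing_inv _ hdet, Matrix.one_apply]
  rw [← h2]
  simp [h]

/-- Solve `θ(x_i)(y) = x_i` for `y` by the implicit function theorem. -/
theorem exists_algHom_comp_eq_id [DecidableEq σ] (θ : ConvSeries σ K →ₐ[K] ConvSeries σ K)
    (h : IsUnit (jacobian θ)) :
    ∃ ψ : ConvSeries σ K →ₐ[K] ConvSeries σ K, ψ.comp θ = AlgHom.id K _ := by
  obtain ⟨S, hS, hS'⟩ := exists_algHom_of_isUnit_jacobian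
    (fun i => incl Function.Embedding.inl (θ (X K i)) - X K (Sum.inr i))
    (fun i => by simp) (by
      convert h using 1
      ext i j
      rw [Matrix.of_apply, map_sub, lin_X, jacobian_apply]
      have := lin_incl (Function.Embedding.inl : σ ↪ σ ⊕ σ) j (θ (X K i))
      rw [Function.Embedding.inl_apply] at this
      simp [this])
  refine ⟨S.comp (incl Function.Embedding.inl), algHom_ext fun i => ?_⟩
  have h1 := hS i
  have h2 := hS' (X K i)
  rw [incl_X, Function.Embedding.inr_apply] at h2
  rw [map_sub, h2, sub_eq_zero] at h1
  exact h1

/-- The inverse function theorem. -/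
theorem bijective_of_isUnit_jacobian [DecidableEq σ] (θ : ConvSeries σ K →ₐ[K] ConvSeries σ K)
    (h : IsUnit (jacobian θ)) : Function.Bijective θ := by
  obtain ⟨ψ, hψ⟩ := exists_algHom_comp_eq_id θ h
  have hJ : jacobian θ * jacobian ψ = 1 := by rw [← jacobian_comp, hψ, jacobian_id]
  -- The left inverse `ψ` itself has a left inverse, hence is injective, which makes it two-sided.
  obtain ⟨χ, hχ⟩ := exists_algHom_comp_eq_id ψ
    ((Matrix.isUnit_iff_isUnit_det _).2 (Matrix.isUnit_det_of_left_inverse hJ))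
  have h1 : Function.LeftInverse ψ θ := DFunLike.congr_fun hψ
  have h2 : Function.LeftInverse χ ψ := DFunLike.congr_fun hχ
  refine ⟨h1.injective, fun f => ⟨ψ f, h2.injective ?_⟩⟩
  exact h1 (ψ f)

theorem isUnit_jacobian_algEquiv [DecidableEq σ] (φ : ConvSeries σ K ≃ₐ[K] ConvSeries σ K) :
    IsUnit (jacobian (φ : ConvSeries σ K →ₐ[K] ConvSeries σ K)) := by
  have h : jacobian (φ.symm : ConvSeries σ K →ₐ[K] ConvSeries σ K) *
      jacobian (φ : ConvSeries σ K →ₐ[K] ConvSeries σ K) = 1 := by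
    rw [← jacobian_comp, AlgEquiv.comp_symm, jacobian_id]
  exact (Matrix.isUnit_iff_isUnit_det _).2 (Matrix.isUnit_det_of_left_inverse h)

end ConvSeries

/-! ### Complements of graphs -/

theorem blockDiagonal_mulVec_apply {β o R : Type*} [Fintype β] [Fintype o] [DecidableEq o]
    [CommRing R] (P : o → Matrix β β R) (v : β × o → R) (b : β) (i : o) :
    (Matrix.blockDiagonal P).mulVec v (b, i) = (P i).mulVec (fun b => v (b, i)) b := by
  simp [Matrix.mulVec, dotProduct, Matrix.blockDiagonal_apply, Fintype.sum_prod_type, ite_mul]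

/-- If in each block every graph `{(N v, v)}` has a complement `{P u + R v = 0}` of a prescribed
type, then every graph has a complement which is a direct sum of subspaces of these types. -/
theorem exists_isUnit_blockDiagonal_mul_add {β o : Type*} [Fintype β] [DecidableEq β] [Fintype o]
    [DecidableEq o] (S : o → Set (Matrix β β K × Matrix β β K))
    (h : ∀ i N, ∃ c ∈ S i, IsUnit (c.1 * N + c.2)) (A : Matrix (β × o) (β × o) K) :
    ∃ c : o → Matrix β β K × Matrix β β K, (∀ i, c i ∈ S i) ∧
      IsUnit (Matrix.blockDiagonal (fun i => (c i).1) * A +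
        Matrix.blockDiagonal fun i => (c i).2) := by
  -- Induction on the set of blocks already treated; the others carry `(0, 1)`, the condition `v_j =
  -- 0`, which is always complementary to a graph.
  suffices H : ∀ s : Finset o, ∃ c : o → Matrix β β K × Matrix β β K, (∀ i ∈ s, c i ∈ S i) ∧
      (∀ i ∉ s, c i = (0, 1)) ∧ IsUnit (Matrix.blockDiagonal (fun i => (c i).1) * A +
        Matrix.blockDiagonal fun i => (c i).2) by
    obtain ⟨c, h1, -, h2⟩ := H Finset.univ
    exact ⟨c, fun i => h1 i (Finset.mem_univ i), h2⟩
  intro s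
  induction s using Finset.induction_on with
  | empty =>
    refine ⟨fun _ => (0, 1), by simp, by simp, ?_⟩
    have h0 : Matrix.blockDiagonal (fun _ : o => (0 : Matrix β β K)) = 0 :=
      Matrix.blockDiagonal_zero
    have h1 : Matrix.blockDiagonal (fun _ : o => (1 : Matrix β β K)) = 1 :=
      Matrix.blockDiagonal_one
    simp [h0, h1]
  | insert i s hi ih =>
    obtain ⟨c, hc1, hc2, hL⟩ := ih
    set L := Matrix.blockDiagonal (fun i => (c i).1) * A +
        Matrix.blockDiagonal fun i => (c i).2 with hLdef
    -- If `L v` is supported in block `i`, it equals `v_i` there, since that block still carries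
    -- `(0, 1)`. So block `i` of `A v = (A L⁻¹)(L v)` depends on `v_i` alone, through this diagonal
    -- block of `A L⁻¹`.
    obtain ⟨d, hd, hdu⟩ := h i (Matrix.of fun b b' => (A * L⁻¹) (b, i) (b', i))
    refine ⟨Function.update c i d, fun j hj => ?_, fun j hj => ?_, ?_⟩
    · rcases eq_or_ne j i with rfl | hji
      · simpa using hd
      · simpa [hji] using hc1 j (Finset.mem_of_mem_insert_of_ne hj hji)
    · rw [Finset.mem_insert, not_or] at hj
      rw [Function.update_of_ne hj.1, hc2 j hj.2]
    · rw [← Matrix.mulVec_injective_iff_isUnit, ← Matrix.coe_mulVecLin,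
        injective_iff_map_eq_zero]
      intro v hv
      have hv' (j : o) (b : β) : (Function.update c i d j).1.mulVec
          (fun b => A.mulVec v (b, j)) b +
          (Function.update c i d j).2.mulVec (fun b => v (b, j)) b = 0 := by
        have := congrFun hv (b, j)
        simpa [Matrix.add_mulVec, ← Matrix.mulVec_mulVec, blockDiagonal_mulVec_apply] using this
      have hLv (j : o) (b : β) : L.mulVec v (b, j) = if j = i then v (b, j) else 0 := by
        rw [hLdef, Matrix.add_mulVec, ← Matrix.mulVec_mulVec, Pi.add_apply,
          blockDiagonal_mulVec_apply, blockDiagonal_mulVec_apply]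
        split_ifs with hji
        · subst hji
          simp [hc2 j hi]
        · have := hv' j b
          rwa [Function.update_of_ne hji] at this
      have hinv : L⁻¹.mulVec (L.mulVec v) = v := by
        rw [Matrix.mulVec_mulVec,
          Matrix.nonsing_inv_mul _ ((Matrix.isUnit_iff_isUnit_det _).1 hL), Matrix.one_mulVec]
      have hvi : (fun b => v (b, i)) = 0 := by
        refine (injective_iff_map_eq_zero (Matrix.mulVecLin _)).1
          (Matrix.mulVec_injective_iff_isUnit.2 hdu) _ ?_
        funext b
        have := hv' i b
        rw [Function.update_self] at this
        rw [Matrix.mulVecLin_apply, Matrix.add_mulVec, ← Matrix.mulVec_mulVec, Pi.add_apply,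
          Pi.zero_apply, ← this]
        congr 3
        funext b
        conv_rhs => rw [← hinv, Matrix.mulVec_mulVec]
        simp only [Matrix.mulVec, dotProduct, Fintype.sum_prod_type, Matrix.of_apply]
        refine Finset.sum_congr rfl fun b' _ => ?_
        have hsum (j : o) : ∑ x, ∑ y, L (b', j) (x, y) * v (x, y) = L.mulVec v (b', j) := by
          simp [Matrix.mulVec, dotProduct, Fintype.sum_prod_type]
        simp_rw [hsum, hLv]
        simp
      rw [← hinv]
      have : L.mulVec v = 0 := by
        funext ⟨b, j⟩
        rw [hLv]
        split_ifs with hji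
        · subst hji
          exact congrFun hvi b
        · rfl
      rw [this, Matrix.mulVec_zero]

/-- For a binary quadratic form `q = a x² + x y + b y²` in characteristic two, every graph
`{(N v, v)}` has a complement on which `q(u) = q(v)`. -/
theorem exists_isUnit_mul_add_of_two_eq_zero (h2 : (2 : K) = 0) {R : Type*}
    [CommRing R] [Algebra K R] (a b : K) (N : Matrix (Fin 2) (Fin 2) K) :
    ∃ c : Matrix (Fin 2) (Fin 2) K × Matrix (Fin 2) (Fin 2) K,
      (∀ u v : Fin 2 → R,
        (∀ i, ∑ j, (c.1 i j • u j + c.2 i j • v j) = 0) →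
        a • u 0 ^ 2 + u 0 * u 1 + b • u 1 ^ 2 = a • v 0 ^ 2 + v 0 * v 1 + b • v 1 ^ 2) ∧
      IsUnit (c.1 * N + c.2) := by
  have key : (2 : R) = 0 := by
    rw [← map_ofNat (algebraMap K R) 2, h2, map_zero]
  -- With `s = u₀ - v₀` and `t = u₁ - v₁`, in characteristic two `q(u) - q(v) = s (a s + u₁) + t (b
  -- t + v₀)`. Killing one factor of each product gives four planes, `H1` to `H4`. On the fifth, `u₀
  -- = b t` and `v₁ = a s`, the difference is `2 s t = 0`. If the first four determinants vanish
  -- then `N = diag(1, 0)`, and there the fifth is `-1`.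
  by_contra! H
  simp_rw [Matrix.isUnit_iff_isUnit_det, isUnit_iff_ne_zero, not_not] at H
  have hdet (P R : Matrix (Fin 2) (Fin 2) K) : (P * N + R).det =
      (P 0 0 * N 0 0 + P 0 1 * N 1 0 + R 0 0) * (P 1 0 * N 0 1 + P 1 1 * N 1 1 + R 1 1) -
        (P 0 0 * N 0 1 + P 0 1 * N 1 1 + R 0 1) * (P 1 0 * N 0 0 + P 1 1 * N 1 0 + R 1 0) := by
    simp only [Matrix.det_fin_two, Matrix.add_apply, Matrix.mul_apply, Fin.sum_univ_two]
  simp_rw [hdet] at H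
  have H1 := H (!![1, 0; 0, 1], !![-1, 0; 0, -1]) (by
    intro u v h
    simp [Fin.forall_fin_two, Algebra.smul_def] at h ⊢
    linear_combination (algebraMap K R a * (u 0 - v 0) + u 1) * h.1 +
      (algebraMap K R b * (u 1 - v 1) + v 0) * h.2 +
      (algebraMap K R a * v 0 * (u 0 - v 0) + algebraMap K R b * v 1 * (u 1 - v 1)) * key)
  have H2 := H (!![1, 0; 0, b], !![-1, 0; 1, -b]) (by
    intro u v h
    simp [Fin.forall_fin_two, Algebra.smul_def] at h ⊢
    linear_combination (algebraMap K R a * (u 0 - v 0) + u 1) * h.1 + (u 1 - v 1) * h.2 +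
      (algebraMap K R a * v 0 * (u 0 - v 0) + algebraMap K R b * v 1 * (u 1 - v 1)) * key)
  have H3 := H (!![a, 1; 0, 1], !![-a, 0; 0, -1]) (by
    intro u v h
    simp [Fin.forall_fin_two, Algebra.smul_def] at h ⊢
    linear_combination (u 0 - v 0) * h.1 + (algebraMap K R b * (u 1 - v 1) + v 0) * h.2 +
      (algebraMap K R a * v 0 * (u 0 - v 0) + algebraMap K R b * v 1 * (u 1 - v 1)) * key)
  have H4 := H (!![a, 1; 0, b], !![-a, 0; 1, -b]) (by
    intro u v h
    simp [Fin.forall_fin_two, Algebra.smul_def] at h ⊢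
    linear_combination (u 0 - v 0) * h.1 + (u 1 - v 1) * h.2 +
      (algebraMap K R a * v 0 * (u 0 - v 0) + algebraMap K R b * v 1 * (u 1 - v 1)) * key)
  have H5 := H (!![1, -b; a, 0], !![0, b; -a, -1]) (by
    intro u v h
    simp [Fin.forall_fin_two, Algebra.smul_def] at h ⊢
    linear_combination (u 0 - v 0) * h.2 - (u 1 - v 1) * h.1 +
      (algebraMap K R a * v 0 * (u 0 - v 0) + algebraMap K R b * v 1 * (u 1 - v 1) +
        (u 0 - v 0) * (u 1 - v 1) + v 1 * (u 0 - v 0) + v 0 * (u 1 - v 1)) * key)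
  simp at H1 H2 H3 H4 H5
  have h01 : N 0 1 = 0 := by linear_combination b * H1 - H2
  have h10 : N 1 0 = 0 := by linear_combination a * H1 - H3
  have h11 : N 1 1 = 0 := by linear_combination a * b * H1 - H4 - b * h10 - a * h01
  have h00 : N 0 0 = 1 := by
    rw [h01, h10, h11] at H1
    linear_combination -H1
  rw [h00, h01, h10, h11] at H5
  simp at H5

namespace ConvSeries

/-! ### Uniqueness of the residual part -/

section Residual

variable {κ : Type*} [Fintype κ]

theorem jacobian_incl_inl [DecidableEq κ] :
    jacobian (incl (K := K) (Function.Embedding.inl : κ ↪ κ ⊕ σ)) = Matrix.fromCols 1 0 := by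
  classical
  ext i (p | p) <;> simp [jacobian_apply, lin_X, Matrix.one_apply, eq_comm]

theorem jacobian_incl_inr [DecidableEq σ] :
    jacobian (incl (K := K) (Function.Embedding.inr : σ ↪ κ ⊕ σ)) = Matrix.fromCols 0 1 := by
  classical
  ext i (p | p) <;> simp [jacobian_apply, lin_X, Matrix.one_apply, eq_comm]

/-- The linear part of an automorphism that respects a splitting `q(y) + g(x)` with `q`
nondegenerate and `g` degenerate is block triangular. -/
theorem toBlocks₁₂_jacobian_eq_zero [DecidableEq κ] [DecidableEq σ]
    (φ : ConvSeries (κ ⊕ σ) K →ₐ[K] ConvSeries (κ ⊕ σ) K) {q : ConvSeries κ K}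
    {g₀ g₁ : ConvSeries σ K} (hq : ∀ i, lin i q = 0) (hQ : IsUnit (hessian q))
    (hg₀ : ∀ i, lin i g₀ = 0) (hg₁ : ∀ i, lin i g₁ = 0) (hg₀' : hessian g₀ = 0)
    (hg₁' : hessian g₁ = 0)
    (h : incl Function.Embedding.inl q + incl Function.Embedding.inr g₀ =
      φ (incl Function.Embedding.inl q + incl Function.Embedding.inr g₁)) :
    (jacobian φ).toBlocks₁₂ = 0 := by
  have hess_split {g : ConvSeries σ K} (hg : ∀ i, lin i g = 0) (hg' : hessian g = 0) :
      hessian (incl Function.Embedding.inl q + incl Function.Embedding.inr g) =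
        Matrix.fromBlocks (hessian q) 0 0 0 := by
    rw [hessian_add, hessian_algHom _ hq, hessian_algHom _ hg, hg', jacobian_incl_inl]
    simp only [Matrix.transpose_fromCols, Matrix.fromRows_mul, Matrix.mul_fromCols,
      Matrix.transpose_one, Matrix.transpose_zero, Matrix.one_mul, Matrix.zero_mul,
      Matrix.mul_one, Matrix.mul_zero, add_zero]
    ext (_ | _) (_ | _) <;> rfl
  have lin_split (p : κ ⊕ σ) :
      lin p (incl Function.Embedding.inl q + incl Function.Embedding.inr g₁) = 0 := by
    rw [map_add, lin_algHom, lin_algHom]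
    simp [hq, hg₁]
  have key := congrArg hessian h
  rw [hessian_algHom φ lin_split, hess_split hg₀ hg₀', hess_split hg₁ hg₁',
    ← Matrix.fromBlocks_toBlocks (jacobian φ), Matrix.fromBlocks_transpose,
    Matrix.fromBlocks_multiply, Matrix.fromBlocks_multiply, Matrix.fromBlocks_inj] at key
  -- With `A`, `B` the upper blocks of the Jacobian and `Q` the Hessian of `q`, these say `Q = Aᵀ Q
  -- A` and `0 = Aᵀ Q B`. The first makes `Aᵀ Q` invertible, so the second gives `B = 0`.
  obtain ⟨k11, k12, -, -⟩ := key
  simp only [Matrix.mul_zero, Matrix.zero_mul, add_zero] at k11 k12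
  set A := (jacobian φ).toBlocks₁₁
  have hAQ : IsUnit (A.transpose * hessian q) := by
    rw [Matrix.isUnit_iff_isUnit_det]
    refine Matrix.isUnit_det_of_right_inverse (B := A * (hessian q)⁻¹) ?_
    rw [← Matrix.mul_assoc, ← k11,
      Matrix.mul_nonsing_inv _ ((Matrix.isUnit_iff_isUnit_det _).1 hQ)]
  rw [← Matrix.nonsing_inv_mul_cancel_left _ (jacobian φ).toBlocks₁₂
    ((Matrix.isUnit_iff_isUnit_det _).1 hAQ), ← k12, Matrix.mul_zero]

/-- If `q(y) + g₀(x)` and `q(y) + g₁(x)` are right equivalent, where `q` is nondegenerate, `g₀`,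
`g₁` are degenerate, and every graph `{(N v, v)}` has a complement on which `q(u) = q(v)`, then
`g₀` and `g₁` are right equivalent. -/
theorem rightEquiv_of_rightEquiv_add {q : ConvSeries κ K} {g₀ g₁ : ConvSeries σ K}
    [DecidableEq κ] (hq : ∀ i, lin i q = 0) (hQ : IsUnit (hessian q))
    (hg₀ : ∀ i, lin i g₀ = 0) (hg₁ : ∀ i, lin i g₁ = 0) (hg₀' : hessian g₀ = 0)
    (hg₁' : hessian g₁ = 0)
    (hc : ∀ N : Matrix κ κ K, ∃ P R : Matrix κ κ K, IsUnit (P * N + R) ∧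
      ∀ α β : ConvSeries κ K →ₐ[K] ConvSeries σ K,
        (∀ i, ∑ j, (P i j • α (X K j) + R i j • β (X K j)) = 0) → α q = β q)
    (h : RightEquiv (incl (Function.Embedding.inl : κ ↪ κ ⊕ σ) q + incl Function.Embedding.inr g₀)
      (incl Function.Embedding.inl q + incl Function.Embedding.inr g₁)) :
    RightEquiv g₀ g₁ := by
  classical
  obtain ⟨φ, hφ⟩ := h
  set Φ := (φ : ConvSeries (κ ⊕ σ) K →ₐ[K] ConvSeries (κ ⊕ σ) K) with hΦ
  have hΦ' (f) : Φ f = φ f := rfl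
  have hM := isUnit_jacobian_algEquiv φ
  rw [← hΦ] at hM
  have hB := toBlocks₁₂_jacobian_eq_zero Φ hq hQ hg₀ hg₁ hg₀' hg₁' hφ
  have hBlin (i : κ) (p : σ) : lin (Sum.inr p) (Φ (X K (Sum.inl i))) = 0 :=
    congrFun (congrFun hB i) p
  rw [← Matrix.fromBlocks_toBlocks (jacobian Φ), hB, Matrix.isUnit_fromBlocks_zero₁₂] at hM
  obtain ⟨P, R, hPR, hq'⟩ := hc (jacobian Φ).toBlocks₁₁
  let F (i : κ) : ConvSeries (κ ⊕ σ) K :=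
    ∑ j, (P i j • Φ (X K (Sum.inl j)) + R i j • X K (Sum.inl j))
  have hFl (i j : κ) : lin (Sum.inl j) (F i) = (P * (jacobian Φ).toBlocks₁₁ + R) i j := by
    simp [F, Finset.sum_add_distrib, lin_X, Matrix.mul_apply, Matrix.toBlocks₁₁, jacobian_apply]
  have hFr (i : κ) (p : σ) : lin (Sum.inr p) (F i) = 0 := by
    simp [F, Finset.sum_add_distrib, lin_X, hBlin]
  obtain ⟨S, hSF, hS⟩ := exists_algHom_of_isUnit_jacobian F
    (fun i => by simp [F, Finset.sum_add_distrib]) (by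
      convert hPR using 1
      ext i j
      exact hFl i j)
  have hSX (i j : σ) : lin j (S (X K (Sum.inr i))) = (1 : Matrix σ σ K) i j := by
    have h1 := hS (X K i)
    rw [incl_X, Function.Embedding.inr_apply] at h1
    rw [h1, lin_X, Matrix.one_apply]
    simp only [eq_comm]
  -- Since `F` has no terms linear in `x`, differentiating `S (F i) = 0` shows that the solution `y
  -- = ψ(x)` has no linear terms.
  have hSY : (jacobian S).toRows₁ = 0 := by
    have h1 : (P * (jacobian Φ).toBlocks₁₁ + R) * (jacobian S).toRows₁ = 0 := by
      ext i p
      have h2 := congrArg (lin p) (hSF i)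
      rw [lin_algHom, Fintype.sum_sum_type] at h2
      simp only [hFl, hFr, zero_mul, Finset.sum_const_zero, add_zero, map_zero] at h2
      exact h2
    rw [← Matrix.nonsing_inv_mul_cancel_left _ (jacobian S).toRows₁
      ((Matrix.isUnit_iff_isUnit_det _).1 hPR), h1, Matrix.mul_zero]
  have hJS : jacobian S = Matrix.fromRows 0 1 := by
    rw [← Matrix.fromRows_toRows (jacobian S), hSY]
    congr 1
    ext i p
    exact hSX i p
  let θ : ConvSeries σ K →ₐ[K] ConvSeries σ K := (S.comp Φ).comp (incl Function.Embedding.inr)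
  have hJθ : jacobian θ = (jacobian Φ).toBlocks₂₂ := by
    rw [jacobian_comp, jacobian_comp, jacobian_incl_inr, hJS]
    conv_lhs => rw [← Matrix.fromBlocks_toBlocks (jacobian Φ), hB]
    rw [Matrix.fromBlocks_mul_fromRows, Matrix.fromCols_mul_fromRows]
    simp
  have hθ := bijective_of_isUnit_jacobian θ (hJθ ▸ hM.2)
  refine ⟨AlgEquiv.ofBijective θ hθ, ?_⟩
  -- On the solution set `u = φ(y)` and `v = y` satisfy `P u + R v = 0`, so the two copies of `q`
  -- cancel in the substituted identity.
  have h1 := hq' ((S.comp Φ).comp (incl Function.Embedding.inl))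
    (S.comp (incl Function.Embedding.inl)) (fun i => by
      rw [← hSF i]
      simp [F])
  have h2 := congrArg S hφ
  rw [map_add, hS, map_add, map_add] at h2
  change g₀ = S (φ (incl Function.Embedding.inr g₁))
  change S (φ (incl Function.Embedding.inl q)) = S (incl Function.Embedding.inl q) at h1
  linear_combination h2 + h1

theorem rightEquiv_of_rightEquiv_incl (e : σ ≃ τ) {f g : ConvSeries σ K}
    (h : RightEquiv (incl e.toEmbedding f) (incl e.toEmbedding g)) : RightEquiv f g := by
  let E : ConvSeries σ K ≃ₐ[K] ConvSeries τ K :=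
    AlgEquiv.ofAlgHom (incl e.toEmbedding) (incl e.symm.toEmbedding)
      (algHom_ext fun i => by simp) (algHom_ext fun i => by simp)
  obtain ⟨φ, hφ⟩ := h
  exact ⟨(E.trans φ).trans E.symm, E.injective (by
    rw [AlgEquiv.trans_apply, AlgEquiv.trans_apply, AlgEquiv.apply_symm_apply]
    exact hφ)⟩

/-- The case of `rightEquiv_of_rightEquiv_add` in which `q` is a sum of forms in separate blocks of
variables. -/
theorem rightEquiv_of_rightEquiv_add_of_blocks {b o : Type*} [Fintype b] [DecidableEq b]
    [Fintype o] [DecidableEq o] {q : ConvSeries (b × o) K} {g₀ g₁ : ConvSeries σ K}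
    (hq : ∀ i, lin i q = 0) (hQ : IsUnit (hessian q))
    (hg₀ : ∀ i, lin i g₀ = 0) (hg₁ : ∀ i, lin i g₁ = 0) (hg₀' : hessian g₀ = 0)
    (hg₁' : hessian g₁ = 0) (Q : o → (b → ConvSeries σ K) → ConvSeries σ K)
    (hqQ : ∀ α : ConvSeries (b × o) K →ₐ[K] ConvSeries σ K,
      α q = ∑ i, Q i fun j => α (X K (j, i)))
    (hc : ∀ i, ∀ N : Matrix b b K, ∃ c : Matrix b b K × Matrix b b K,
      (∀ u v : b → ConvSeries σ K, (∀ j, ∑ k, (c.1 j k • u k + c.2 j k • v k) = 0) →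
        Q i u = Q i v) ∧ IsUnit (c.1 * N + c.2))
    (h : RightEquiv
      (incl (Function.Embedding.inl : b × o ↪ b × o ⊕ σ) q + incl Function.Embedding.inr g₀)
      (incl Function.Embedding.inl q + incl Function.Embedding.inr g₁)) :
    RightEquiv g₀ g₁ := by
  refine rightEquiv_of_rightEquiv_add hq hQ hg₀ hg₁ hg₀' hg₁' (fun N => ?_) h
  obtain ⟨c, hc1, hc2⟩ := exists_isUnit_blockDiagonal_mul_add _ hc N
  refine ⟨_, _, hc2, fun α β hαβ => ?_⟩
  rw [hqQ, hqQ]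
  refine Finset.sum_congr rfl fun i _ => hc1 i _ _ fun j => ?_
  rw [← hαβ (j, i)]
  simp [Fintype.sum_prod_type, Matrix.blockDiagonal_apply, ite_smul, Finset.sum_add_distrib]

end Residual

/-! ### The two normal forms of the quadratic part -/

theorem hess_X_sq (p q i : σ) :
    hess p q (X K i ^ 2 : ConvSeries σ K) = 2 * (lin p (X K i) * lin q (X K i)) := by
  rw [pow_two, hess_mul _ _ (constCoeff_X i) (constCoeff_X i)]
  ring

/-- The residual parts `∑ dᵢ xᵢ² + h` with `h ∈ 𝔪³` have no linear part. -/
theorem lin_sum_smul_X_sq_add (d : σ → K) {h : ConvSeries σ K} (hh : h ∈ maxIdeal σ K ^ 3)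
    (i : σ) : lin i ((∑ j, d j • X K j ^ 2) + h) = 0 := by
  simp [lin_eq_zero_of_mem_maxIdeal_pow hh, pow_two, lin_mul]

/-- The second derivative of a square is a multiple of 2, so the squares in the residual part are
invisible to the Hessian. -/
theorem hessian_sum_smul_X_sq_add (h2 : (2 : K) = 0) (d : σ → K) {h : ConvSeries σ K}
    (hh : h ∈ maxIdeal σ K ^ 3) : hessian ((∑ j, d j • X K j ^ 2) + h) = 0 := by
  classical
  ext p q
  simp [hessian_apply, hess_eq_zero_of_mem_maxIdeal_pow hh, hess_X_sq, h2]

/-- Each variable is a block. Both lines `u = v` and `u = -v` preserve `a u ^ 2`, and as `2 ≠ 0` at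
least one of them differs from the graph `u = N v`. -/
theorem rightEquiv_of_rightEquiv_diagForm (h2 : (2 : K) ≠ 0) {k m : ℕ} {a : Fin k → K}
    (ha : ∀ i, a i ≠ 0) {g₀ g₁ : ConvSeries (Fin m) K} (hg₀ : g₀ ∈ maxIdeal (Fin m) K ^ 3)
    (hg₁ : g₁ ∈ maxIdeal (Fin m) K ^ 3)
    (h : RightEquiv (diagForm m a + inLast k g₀) (diagForm m a + inLast k g₁)) :
    RightEquiv g₀ g₁ := by
  let q : ConvSeries (Unit × Fin k) K := ∑ i, a i • X K ((), i) ^ 2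
  let e : Unit × Fin k ⊕ Fin m ≃ Fin (k + m) :=
    ((Equiv.punitProd _).sumCongr (Equiv.refl _)).trans finSumFinEquiv
  have he (g : ConvSeries (Fin m) K) : incl e.toEmbedding
      (incl Function.Embedding.inl q + incl Function.Embedding.inr g) =
      diagForm m a + inLast k g := by
    rw [map_add]
    congr 1
    · simp [q, diagForm, e]
    · have : (incl e.toEmbedding).comp (incl Function.Embedding.inr) = inLast (K := K) k :=
        algHom_ext fun i => by simp [e, inLast]
      exact DFunLike.congr_fun this g
  rw [← he, ← he] at h
  refine rightEquiv_of_rightEquiv_add_of_blocks (q := q) (fun i => ?_) ?_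
    (lin_eq_zero_of_mem_maxIdeal_pow hg₀) (lin_eq_zero_of_mem_maxIdeal_pow hg₁)
    (by ext p q; exact hess_eq_zero_of_mem_maxIdeal_pow hg₀ p q)
    (by ext p q; exact hess_eq_zero_of_mem_maxIdeal_pow hg₁ p q)
    (fun i u => a i • u () ^ 2) (fun α => by simp [q]) (fun i N => ?_)
    (rightEquiv_of_rightEquiv_incl e h)
  · simp [q, pow_two, lin_mul]
  · have : hessian q = Matrix.diagonal fun i => 2 * a i.2 := by
      ext ⟨⟨⟩, i⟩ ⟨⟨⟩, j⟩
      simp only [hessian_apply, q, map_sum, map_smul, smul_eq_mul, hess_X_sq, lin_X,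
        Matrix.diagonal_apply, Prod.mk.injEq, true_and]
      rw [Finset.sum_eq_single i (fun x _ hx => by simp [hx.symm]) (by simp)]
      rcases eq_or_ne i j with rfl | hij
      · simp [mul_comm]
      · simp [hij, hij.symm]
    rw [this, Matrix.isUnit_iff_isUnit_det, Matrix.det_diagonal, isUnit_iff_ne_zero]
    exact Finset.prod_ne_zero_iff.2 fun i _ => mul_ne_zero h2 (ha i.2)
  · simp_rw [Matrix.isUnit_iff_isUnit_det, isUnit_iff_ne_zero]
    by_cases hN : N () () = 1
    · refine ⟨(1, 1), fun u v huv => ?_, ?_⟩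
      · have := huv ()
        simp only [Finset.univ_unique, Finset.sum_singleton, PUnit.default_eq_unit,
          Matrix.one_apply_eq, one_smul] at this
        change a i • u PUnit.unit ^ 2 = _
        rw [eq_neg_of_add_eq_zero_left this, neg_sq (v PUnit.unit)]
      · simpa [hN, one_add_one_eq_two] using h2
    · refine ⟨(1, -1), fun u v huv => ?_, ?_⟩
      · have := huv ()
        simp only [Finset.univ_unique, Finset.sum_singleton, PUnit.default_eq_unit,
          Matrix.one_apply_eq, one_smul, Matrix.neg_apply, neg_smul] at this
        change a i • u PUnit.unit ^ 2 = _
        rw [eq_of_sub_eq_zero ((sub_eq_add_neg _ _).trans this)]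
      · simpa [← sub_eq_add_neg, sub_eq_zero] using hN

/-- Each pair of variables is a block. Its Hessian is `!![0, 1; 1, 0]` whatever the coefficients of
the squares, hence invertible. -/
theorem rightEquiv_of_rightEquiv_blockForm (h2 : (2 : K) = 0) {l m : ℕ} {a : Fin (2 * l) → K}
    {g₀ g₁ : ConvSeries (Fin m) K} (hg₀ : ∀ i, lin i g₀ = 0) (hg₁ : ∀ i, lin i g₁ = 0)
    (hg₀' : hessian g₀ = 0) (hg₁' : hessian g₁ = 0)
    (h : RightEquiv (blockForm m a + inLast (2 * l) g₀) (blockForm m a + inLast (2 * l) g₁)) :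
    RightEquiv g₀ g₁ := by
  let a₀ (j : Fin l) : K := a ⟨2 * j, by omega⟩
  let a₁ (j : Fin l) : K := a ⟨2 * j + 1, by omega⟩
  let q : ConvSeries (Fin 2 × Fin l) K :=
    ∑ j, (a₀ j • X K (0, j) ^ 2 + X K (0, j) * X K (1, j) + a₁ j • X K (1, j) ^ 2)
  -- Sends `(b, j)` to `2 * j + b`, so that the block index `j` comes second, as in
  -- `Matrix.blockDiagonal`.
  let e : Fin 2 × Fin l ⊕ Fin m ≃ Fin (2 * l + m) :=
    ((((Equiv.prodComm _ _).trans finProdFinEquiv).trans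
      (finCongr (Nat.mul_comm l 2))).sumCongr (Equiv.refl _)).trans finSumFinEquiv
  have he0 (j : Fin l) : e (Sum.inl (0, j)) = ⟨2 * j, by omega⟩ := by
    ext
    simp [e]
  have he1 (j : Fin l) : e (Sum.inl (1, j)) = ⟨2 * j + 1, by omega⟩ := by
    ext
    simp [e, add_comm]
  have he (g : ConvSeries (Fin m) K) : incl e.toEmbedding
      (incl Function.Embedding.inl q + incl Function.Embedding.inr g) =
      blockForm m a + inLast (2 * l) g := by
    rw [map_add]
    congr 1
    · simp [q, blockForm, he0, he1, a₀, a₁]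
    · have : (incl e.toEmbedding).comp (incl Function.Embedding.inr) = inLast (K := K) (2 * l) :=
        algHom_ext fun i => by simp [e, inLast]
      exact DFunLike.congr_fun this g
  rw [← he, ← he] at h
  refine rightEquiv_of_rightEquiv_add_of_blocks (q := q) (fun i => ?_) ?_ hg₀ hg₁ hg₀' hg₁'
    (fun j u => a₀ j • u 0 ^ 2 + u 0 * u 1 + a₁ j • u 1 ^ 2) (fun α => by simp [q])
    (fun i N => exists_isUnit_mul_add_of_two_eq_zero h2 (a₀ i) (a₁ i) N)
    (rightEquiv_of_rightEquiv_incl e h)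
  · simp [q, pow_two, lin_mul]
  · have : hessian q = Matrix.blockDiagonal fun _ => !![0, 1; 1, 0] := by
      ext ⟨b, i⟩ ⟨c, j⟩
      simp only [hessian_apply, q, map_sum, map_add, map_smul, smul_eq_mul, hess_X_sq, h2, zero_mul,
        mul_zero, zero_add, add_zero, hess_mul _ _ (constCoeff_X _) (constCoeff_X _), lin_X,
        Matrix.blockDiagonal_apply]
      rcases eq_or_ne i j with rfl | hij
      · fin_cases b <;> fin_cases c <;> simp
      · fin_cases b <;> fin_cases c <;> simp [hij, Ne.symm hij]
    rw [this, Matrix.isUnit_iff_isUnit_det, Matrix.det_blockDiagonal]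
    simp

end ConvSeries

end SplittingLemma

end

open SplittingLemma SplittingLemma.ConvSeries in
theorem proposition2p7 {K : Type*} [NormedField K] :
    (ringChar K ≠ 2 → ∀ (k m : ℕ) (a : Fin k → K), (∀ i, a i ≠ 0) →
      ∀ g₀ g₁ : ConvSeries (Fin m) K, g₀ ∈ maxIdeal (Fin m) K ^ 3 → g₁ ∈ maxIdeal (Fin m) K ^ 3 →
        RightEquiv (diagForm m a + inLast k g₀) (diagForm m a + inLast k g₁) →
          RightEquiv g₀ g₁) ∧
    (ringChar K = 2 → ∀ (l m : ℕ) (a : Fin (2 * l) → K) (d : Fin m → K), (∀ i, d i ≠ 0) →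
      ∀ h₀ h₁ : ConvSeries (Fin m) K, h₀ ∈ maxIdeal (Fin m) K ^ 3 → h₁ ∈ maxIdeal (Fin m) K ^ 3 →
      ∀ g₀ g₁ : ConvSeries (Fin m) K,
        g₀ = (∑ i, d i • X K i ^ 2) + h₀ → g₁ = (∑ i, d i • X K i ^ 2) + h₁ →
        RightEquiv (blockForm m a + inLast (2 * l) g₀) (blockForm m a + inLast (2 * l) g₁) →
          RightEquiv g₀ g₁) := by
  refine ⟨fun hK k m a ha g₀ g₁ hg₀ hg₁ h =>
    rightEquiv_of_rightEquiv_diagForm (Ring.two_ne_zero hK) ha hg₀ hg₁ h, ?_⟩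
  rintro hK l m a d - h₀ h₁ hh₀ hh₁ _ _ rfl rfl h
  have h2 : (2 : K) = 0 := by
    have := ringChar.Nat.cast_ringChar (R := K)
    rwa [hK] at this
  exact rightEquiv_of_rightEquiv_blockForm h2 (lin_sum_smul_X_sq_add d hh₀)
    (lin_sum_smul_X_sq_add d hh₁) (hessian_sum_smul_X_sq_add h2 d hh₀)
    (hessian_sum_smul_X_sq_add h2 d hh₁) h
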